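/- **Theorem (small-disturbance ISS of the Gauss-Newton method for LQR).** Let $A\in\mathbb R^{n\times n}$, $B\in\mathbb R^{n\times m}$, let $Q\in\mathbb R^{n\times n}$ and $R\in\mathbb R^{m\times m}$ be symmetric positive definite, and let $(A,B)$ be stabilizable. Let $\mathcal G=\{K\in\mathbb R^{m\times n}: A-BK \text{ is Hurwitz}\}$. For $K\in\mathcal G$ let $P_K$ and $Y_K$ be the solutions of $$(A-BK)^\top P_K+P_K(A-BK)+Q+K^\top RK=0,\qquad (A-BK)Y_K+Y_K(A-BK)^\top+I_n=0,$$ and put $\mathcal J_2(K)=\operatorname{Tr}P_K$. Let $P^*$ be the positive definite solution of the algebraic Riccati equation $\mathcal R(P^*)=0$, where $\mathcal R(X)=A^\top X+XA-XBR^{-1}B^\top X+Q$; put $K^*=R^{-1}B^\top P^*$, $Y^*=Y_{K^*}$, $\langle K_1,K_2\rangle_{Y^*}=\operatorname{Tr}(K_1Y^*K_2^\top)$, and, with the spectral norm $\|\cdot\|$, $$c(K)=1+\|Y^*\|\,\|BR^{-1}B^\top\|\operatorname{Tr}P_K .$$ A *size function* for $(\mathcal G,K^*)$ is a function $\mathcal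 V$ that is continuous on $\mathcal G$, satisfies $\mathcal V(K^*)=0$ and $\mathcal V(K)>0$ for all other $K\in\mathcal G$, and tends to infinity along every sequence in $\mathcal G$ that approaches $\partial\mathcal G$ or whose norm tends to infinity. A function is of class $\mathcal K$ on an interval $[0,d)$ if it is continuous and strictly increasing there and vanishes at $0$. A $\mathcal{KL}$-function is a function $\beta(r,t)$ of $r,t\ge 0$ that is of class $\mathcal K$ on $[0,\infty)$ in $r$ for each fixed $t$, and is nonincreasing in $t$ with limit $0$ as $t\to\infty$ for each fixed $r$. Let $\eta_0:\mathcal G\to(0,\infty)$ be any continuous function with $\eta_0(K)\le\min\{1,\frac1{4c(K)}\}$ for all $K\in\mathcal G$. Consider the perturbed Gauss-Newton method $$K(k+1)=K(k)-\eta(k)\bigl(K(k)-R^{-1}B^\top P_{K(k)}+W(k)\bigr)\qquad(\ast)$$ with arbitrary step sizes $\eta_0(K(k))\le\eta(k)\le\min\{1,\frac1{4c(K(k))}\}$ (in particular, any step-size rule $\eta(k)=\eta_0(K(k))$). 1. The method $(\ast)$ is small-disturbance ISS with respect to $W$: there are a size function $\mathcal V$ for $(\mathcal G,K^*)$, a $d\in(0,\infty]$,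 a $\mathcal{KL}$-function $\beta$ and a function $\gamma$ of class $\mathcal K$ on $[0,d)$ such that for every bounded sequence $W$ in $\mathbb R^{m\times n}$ with $\|W\|_\infty=\sup_k\|W(k)\|_F<d$, every $K(0)\in\mathcal G$ and every choice of the step sizes $\eta(k)$ as above, $K(k)$ remains in $\mathcal G$ and $$\mathcal V(K(k))\le\beta(\mathcal V(K(0)),k)+\gamma(\|W\|_\infty)\qquad\text{for all }k\ge 0 .$$ 2. The function $\mathcal V_6(K)=\mathcal J_2(K)-\mathcal J_2(K^*)+\frac12\langle K-K^*,R(K-K^*)\rangle_{Y^*}$ is a small-disturbance ISS-Lyapunov function for $(\ast)$: it is a size function for $(\mathcal G,K^*)$, and there are a function $\alpha_1$ of class $\mathcal K$ on $[0,\infty)$ and a continuous positive definite function $\alpha_2$ on $[0,\infty)$ such that, whenever $K\in\mathcal G$, $\|W\|_F\le\alpha_1(\mathcal V_6(K))$ and $\eta_0(K)\le\eta\le\min\{1,\frac1{4c(K)}\}$, the gain $K'=K-\eta(K-R^{-1}B^\top P_K+W)$ lies in $\mathcal G$ and $\mathcal V_6(K')-\mathcal V_6(K)\le-\alpha_2(\mathcal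 V_6(K))$. 3. Without perturbation, the method coincides with Newton's method for the Riccati equation: if $X\in\mathbb R^{n\times n}$ is symmetric with $K=R^{-1}B^\top X\in\mathcal G$, then the linearized equation $D\mathcal R(X)[N]=-\mathcal R(X)$ has exactly one solution $N$, and for every $\eta\in\mathbb R$ the Newton iterate $X'=X+\eta N$ satisfies $R^{-1}B^\top X'=K-\eta(K-R^{-1}B^\top P_K)$. -/

import Mathlib

open Set Filter Topology
open scoped Matrix ENNReal

attribute [local instance] Matrix.frobeniusNormedAddCommGroup Matrix.frobeniusNormedSpace

noncomputable section

/-! ### Comparison functions, size functions, small-disturbance ISS -/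

/-- `α` is continuous, strictly increasing on `I` and vanishes at zero. For `I = [0, ∞)` this is a
`𝒦`-function, for `I = [0, d)` a `𝒦_{[0,d)}`-function. -/
def IsClassKOn (I : Set ℝ) (α : ℝ → ℝ) : Prop :=
  ContinuousOn α I ∧ StrictMonoOn α I ∧ α 0 = 0

/-- `𝒦ℒ`-functions. -/
def IsClassKL (β : ℝ → ℝ → ℝ) : Prop :=
  (∀ t, 0 ≤ t → IsClassKOn (Ici 0) (fun r => β r t)) ∧
  (∀ r, 0 ≤ r → AntitoneOn (β r) (Ici 0) ∧ Tendsto (β r) atTop (𝓝 0))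

/-- The interval `[0, d)`, where `d` may be `∞`. -/
def halfOpen (d : ℝ≥0∞) : Set ℝ := {r | 0 ≤ r ∧ ENNReal.ofReal r < d}

/-- `V` is a size function for `(S, xs)`: continuous on `S`, positive definite with respect to
`xs`, and tending to infinity along every sequence in `S` that approaches the boundary of `S` or is
unbounded in norm. (The extended distance to an empty boundary is `∞`.) -/
structure IsSizeFunction {E : Type*} [NormedAddCommGroup E] (S : Set E) (xs : E) (V : E → ℝ) :
    Prop where
  continuousOn : ContinuousOn V S
  zero_at : V xs = 0
  pos : ∀ x ∈ S, x ≠ xs → 0 < V x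
  coercive : ∀ x : ℕ → E, (∀ k, x k ∈ S) →
    (Tendsto (fun k => Metric.infEDist (x k) (frontier S)) atTop (𝓝 0) ∨
      Tendsto (fun k => ‖x k‖) atTop atTop) →
    Tendsto (fun k => V (x k)) atTop atTop

/-- Small-disturbance input-to-state stability of the discrete-time system
`x (k+1) ∈ F (x k) (w k)` on the state set `S` with respect to the equilibrium `xs`.
For a difference equation `F x u` is a singleton; a larger set allows for a further choice at each
step (below: the choice of the step size), and the estimate is uniform in these choices. -/
def SmallDisturbanceISS {E U : Type*} [NormedAddCommGroup E] [NormedAddCommGroup U]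
    (S : Set E) (xs : E) (F : E → U → Set E) : Prop :=
  ∃ V : E → ℝ, IsSizeFunction S xs V ∧
  ∃ d : ℝ≥0∞, 0 < d ∧
  ∃ β : ℝ → ℝ → ℝ, IsClassKL β ∧
  ∃ γ : ℝ → ℝ, IsClassKOn (halfOpen d) γ ∧
    ∀ (x : ℕ → E) (w : ℕ → U), x 0 ∈ S →
      BddAbove (range fun k => ‖w k‖) → ENNReal.ofReal (⨆ k, ‖w k‖) < d →
      (∀ k, x (k + 1) ∈ F (x k) (w k)) →
      ∀ k : ℕ, x k ∈ S ∧ V (x k) ≤ β (V (x 0)) k + γ (⨆ j, ‖w j‖)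

/-- `V` is a small-disturbance ISS-Lyapunov function for `x (k+1) ∈ F (x k) (w k)`, with decay rate
`α₂` continuous and positive definite. -/
def IsSmallDisturbanceISSLyapunov {E U : Type*} [NormedAddCommGroup E] [NormedAddCommGroup U]
    (S : Set E) (xs : E) (F : E → U → Set E) (V : E → ℝ) : Prop :=
  IsSizeFunction S xs V ∧
  ∃ α₁ : ℝ → ℝ, IsClassKOn (Ici 0) α₁ ∧
  ∃ α₂ : ℝ → ℝ, ContinuousOn α₂ (Ici 0) ∧ α₂ 0 = 0 ∧ (∀ r, 0 < r → 0 < α₂ r) ∧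
    ∀ x ∈ S, ∀ u : U, ‖u‖ ≤ α₁ (V x) →
      ∀ x' ∈ F x u, x' ∈ S ∧ V x' - V x ≤ -α₂ (V x)

/-! ### The linear quadratic regulator -/

variable {n m : ℕ}

/-- All complex eigenvalues have negative real part. -/
def IsHurwitz (M : Matrix (Fin n) (Fin n) ℝ) : Prop :=
  ∀ μ ∈ spectrum ℂ (M.map (algebraMap ℝ ℂ)), μ.re < 0

/-- The set `𝒢` of stabilizing gains. -/
def stabilizing (A : Matrix (Fin n) (Fin n) ℝ) (B : Matrix (Fin n) (Fin m) ℝ) :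
    Set (Matrix (Fin m) (Fin n) ℝ) :=
  {K | IsHurwitz (A - B * K)}

/-- `(A, B)` is stabilizable. -/
def IsStabilizable (A : Matrix (Fin n) (Fin n) ℝ) (B : Matrix (Fin n) (Fin m) ℝ) : Prop :=
  (stabilizing A B).Nonempty

open Classical in
/-- The solution `P` of the Lyapunov equation `Fᵀ P + P F + M = 0` (unique if `F` is Hurwitz). -/
def lyapunovSol (F M : Matrix (Fin n) (Fin n) ℝ) : Matrix (Fin n) (Fin n) ℝ :=
  if h : ∃ P : Matrix (Fin n) (Fin n) ℝ, Fᵀ * P + P * F + M = 0 then h.choose else 0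

/-- The cost matrix `P_K`. -/
def costMatrix (A : Matrix (Fin n) (Fin n) ℝ) (B : Matrix (Fin n) (Fin m) ℝ)
    (Q : Matrix (Fin n) (Fin n) ℝ) (R : Matrix (Fin m) (Fin m) ℝ)
    (K : Matrix (Fin m) (Fin n) ℝ) : Matrix (Fin n) (Fin n) ℝ :=
  lyapunovSol (A - B * K) (Q + Kᵀ * R * K)

/-- The matrix `Y_K`, solution of `(A - B K) Y + Y (A - B K)ᵀ + I = 0`. -/
def gramian (A : Matrix (Fin n) (Fin n) ℝ) (B : Matrix (Fin n) (Fin m) ℝ)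
    (K : Matrix (Fin m) (Fin n) ℝ) : Matrix (Fin n) (Fin n) ℝ :=
  lyapunovSol (A - B * K)ᵀ 1

/-- The LQR cost `𝒥₂(K) = Tr P_K`. -/
def lqrCost (A : Matrix (Fin n) (Fin n) ℝ) (B : Matrix (Fin n) (Fin m) ℝ)
    (Q : Matrix (Fin n) (Fin n) ℝ) (R : Matrix (Fin m) (Fin m) ℝ)
    (K : Matrix (Fin m) (Fin n) ℝ) : ℝ :=
  (costMatrix A B Q R K).trace

/-- The Riccati operator. -/
def riccati (A : Matrix (Fin n) (Fin n) ℝ) (B : Matrix (Fin n) (Fin m) ℝ)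
    (Q : Matrix (Fin n) (Fin n) ℝ) (R : Matrix (Fin m) (Fin m) ℝ)
    (X : Matrix (Fin n) (Fin n) ℝ) : Matrix (Fin n) (Fin n) ℝ :=
  Aᵀ * X + X * A - X * B * R⁻¹ * Bᵀ * X + Q

open Classical in
/-- The positive definite solution `P*` of the algebraic Riccati equation. -/
def areSol (A : Matrix (Fin n) (Fin n) ℝ) (B : Matrix (Fin n) (Fin m) ℝ)
    (Q : Matrix (Fin n) (Fin n) ℝ) (R : Matrix (Fin m) (Fin m) ℝ) : Matrix (Fin n) (Fin n) ℝ :=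
  if h : ∃ P : Matrix (Fin n) (Fin n) ℝ, P.PosDef ∧ riccati A B Q R P = 0 then h.choose else 0

/-- The gain `R⁻¹ Bᵀ X`. -/
def gainOf (B : Matrix (Fin n) (Fin m) ℝ) (R : Matrix (Fin m) (Fin m) ℝ)
    (X : Matrix (Fin n) (Fin n) ℝ) : Matrix (Fin m) (Fin n) ℝ :=
  R⁻¹ * Bᵀ * X

/-- The optimal gain `K* = R⁻¹ Bᵀ P*`. -/
def optGain (A : Matrix (Fin n) (Fin n) ℝ) (B : Matrix (Fin n) (Fin m) ℝ)
    (Q : Matrix (Fin n) (Fin n) ℝ) (R : Matrix (Fin m) (Fin m) ℝ) : Matrix (Fin m) (Fin n) ℝ :=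
  gainOf B R (areSol A B Q R)

/-- The spectral norm of a square matrix. -/
def spectralNorm₂ (M : Matrix (Fin n) (Fin n) ℝ) : ℝ := ‖Matrix.toEuclideanCLM (𝕜 := ℝ) M‖

/-- `c(K) = 1 + ‖Y*‖ ‖B R⁻¹ Bᵀ‖ Tr P_K`. -/
def stepConst (A : Matrix (Fin n) (Fin n) ℝ) (B : Matrix (Fin n) (Fin m) ℝ)
    (Q : Matrix (Fin n) (Fin n) ℝ) (R : Matrix (Fin m) (Fin m) ℝ)
    (K : Matrix (Fin m) (Fin n) ℝ) : ℝ :=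
  1 + spectralNorm₂ (gramian A B (optGain A B Q R)) * spectralNorm₂ (B * R⁻¹ * Bᵀ) *
    (costMatrix A B Q R K).trace

/-- The largest step size allowed at `K`: `min {1, 1 / (4 c(K))}`. -/
def maxStep (A : Matrix (Fin n) (Fin n) ℝ) (B : Matrix (Fin n) (Fin m) ℝ)
    (Q : Matrix (Fin n) (Fin n) ℝ) (R : Matrix (Fin m) (Fin m) ℝ)
    (K : Matrix (Fin m) (Fin n) ℝ) : ℝ :=
  min 1 (1 / (4 * stepConst A B Q R K))

/-- One perturbed Gauss-Newton update `K - η (K - R⁻¹ Bᵀ P_K + W)`. -/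
def gaussNewtonUpdate (A : Matrix (Fin n) (Fin n) ℝ) (B : Matrix (Fin n) (Fin m) ℝ)
    (Q : Matrix (Fin n) (Fin n) ℝ) (R : Matrix (Fin m) (Fin m) ℝ)
    (η : ℝ) (K W : Matrix (Fin m) (Fin n) ℝ) : Matrix (Fin m) (Fin n) ℝ :=
  K - η • (K - gainOf B R (costMatrix A B Q R K) + W)

/-- The perturbed Gauss-Newton method with step sizes `η₀(K) ≤ η ≤ min {1, 1 / (4 c(K))}`: the set
of possible successors of the gain `K` under the perturbation `W`. At a gain that is not
stabilizing the step size is not restricted at all, so that no trajectory is lost by the lack of an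
admissible step. -/
def gaussNewton (A : Matrix (Fin n) (Fin n) ℝ) (B : Matrix (Fin n) (Fin m) ℝ)
    (Q : Matrix (Fin n) (Fin n) ℝ) (R : Matrix (Fin m) (Fin m) ℝ)
    (η₀ : Matrix (Fin m) (Fin n) ℝ → ℝ) (K W : Matrix (Fin m) (Fin n) ℝ) :
    Set (Matrix (Fin m) (Fin n) ℝ) :=
  {K' | ∃ η : ℝ, (K ∈ stabilizing A B → η₀ K ≤ η ∧ η ≤ maxStep A B Q R K) ∧
    K' = gaussNewtonUpdate A B Q R η K W}

/-- `⟨K₁, K₂⟩_Y = Tr (K₁ Y K₂ᵀ)`. -/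
def innerY (Y : Matrix (Fin n) (Fin n) ℝ) (K₁ K₂ : Matrix (Fin m) (Fin n) ℝ) : ℝ :=
  (K₁ * Y * K₂ᵀ).trace

/-- `𝒥₂(K) - 𝒥₂(K*) + ½ ⟨K - K*, R (K - K*)⟩_{Y*}`. -/
def gaussNewtonLyapunov (A : Matrix (Fin n) (Fin n) ℝ) (B : Matrix (Fin n) (Fin m) ℝ)
    (Q : Matrix (Fin n) (Fin n) ℝ) (R : Matrix (Fin m) (Fin m) ℝ)
    (K : Matrix (Fin m) (Fin n) ℝ) : ℝ :=
  lqrCost A B Q R K - lqrCost A B Q R (optGain A B Q R) +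
    1 / 2 * innerY (gramian A B (optGain A B Q R)) (K - optGain A B Q R)
      (R * (K - optGain A B Q R))

/-- `X'` is a Newton step with step size `η` from `X` for the Riccati equation: `X' = X + η N`,
where `N` solves the linearized equation `D𝓡(X)[N] = -𝓡(X)`. -/
def IsNewtonStep (A : Matrix (Fin n) (Fin n) ℝ) (B : Matrix (Fin n) (Fin m) ℝ)
    (Q : Matrix (Fin n) (Fin n) ℝ) (R : Matrix (Fin m) (Fin m) ℝ)
    (η : ℝ) (X X' : Matrix (Fin n) (Fin n) ℝ) : Prop :=
  ∃ N : Matrix (Fin n) (Fin n) ℝ,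
    fderiv ℝ (riccati A B Q R) X N = -riccati A B Q R X ∧ X' = X + η • N

end

/-! ### Real quadratic forms and the Frobenius norm -/

/-! Write `E = K - K*`, `M = K - R⁻¹BᵀP_K`, `h = 𝒥₂(K) - 𝒥₂(K*)` and `e = ⟨E, RE⟩_{Y*}`, so that `𝒱₆
= h + e/2`. Pairing the Lyapunov equation for `P_K - P*` with `Y*` gives the exact identity `2⟨E,
RM⟩_{Y*} = h + e` (`lqrCost_sub_eq`). Hence an unperturbed step changes `e` by `-η(h + e) + η²⟨M,
RM⟩_{Y*}`. By `innerY_gainError_le` the last inner product is at most `2c(K)(h + e)`, and `ηc(K) ≤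
1/4` lets the linear term dominate. The cost itself does not increase in an unperturbed step. Under
a perturbation it grows at most by a factor `1/(1 - ηκ‖W‖²)`, because the stage cost `Q` absorbs
`WᵀRW` (`gaussNewtonUpdate_mem_and_lqrCost_le`). Altogether `𝒱₆` decays at rate `η/16` up to an
error quadratic in `W` (`gaussNewtonLyapunov_step`).

Compactness of the cost sublevel sets makes `𝒱₆` a size function and bounds `η₀` from below by a
positive function of `𝒱₆` alone (`exists_stepSize_minorant`). Both stability claims then follow from
the scalar recursion, with `𝒱₆` itself as the size function.

The Lyapunov equation is treated algebraically. Solvability comes from Cayley-Hamilton, and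
positivity from a homotopy to `-I`, with no matrix exponential. Newton's method reduces to the same
equation, since the derivative of the Riccati operator at a symmetric `X` is the Lyapunov operator
of the closed loop with gain `R⁻¹BᵀX`. -/

theorem posSemidef_real_iff {ι : Type*} [Fintype ι] {M : Matrix ι ι ℝ} :
    M.PosSemidef ↔ Mᵀ = M ∧ ∀ x : ι → ℝ, 0 ≤ x ⬝ᵥ (M *ᵥ x) := by
  rw [Matrix.posSemidef_iff_dotProduct_mulVec]
  simp [Matrix.IsHermitian]

theorem posDef_real_iff {ι : Type*} [Fintype ι] {M : Matrix ι ι ℝ} :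
    M.PosDef ↔ Mᵀ = M ∧ ∀ x : ι → ℝ, x ≠ 0 → 0 < x ⬝ᵥ (M *ᵥ x) := by
  rw [Matrix.posDef_iff_dotProduct_mulVec]
  simp [Matrix.IsHermitian]

theorem Matrix.PosSemidef.transpose_eq {ι : Type*} [Fintype ι] {M : Matrix ι ι ℝ}
    (h : M.PosSemidef) : Mᵀ = M := (posSemidef_real_iff.1 h).1

theorem Matrix.PosSemidef.quad_nonneg {ι : Type*} [Fintype ι] {M : Matrix ι ι ℝ}
    (h : M.PosSemidef) (x : ι → ℝ) : 0 ≤ x ⬝ᵥ (M *ᵥ x) := (posSemidef_real_iff.1 h).2 x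

theorem Matrix.PosDef.transpose_eq {ι : Type*} [Fintype ι] {M : Matrix ι ι ℝ}
    (h : M.PosDef) : Mᵀ = M := h.posSemidef.transpose_eq

theorem Matrix.PosDef.quad_pos {ι : Type*} [Fintype ι] {M : Matrix ι ι ℝ}
    (h : M.PosDef) {x : ι → ℝ} (hx : x ≠ 0) : 0 < x ⬝ᵥ (M *ᵥ x) := (posDef_real_iff.1 h).2 x hx

theorem Matrix.PosSemidef.transpose_mul_mul_same {ι κ : Type*} [Fintype ι] [Fintype κ]
    {M : Matrix ι ι ℝ} (h : M.PosSemidef) (C : Matrix ι κ ℝ) : (Cᵀ * M * C).PosSemidef := by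
  simpa using h.conjTranspose_mul_mul_same C

theorem dotProduct_self_nonneg_real {ι : Type*} [Fintype ι] (x : ι → ℝ) : 0 ≤ x ⬝ᵥ x :=
  Finset.sum_nonneg fun _ _ => mul_self_nonneg _

theorem dotProduct_self_pos_real {ι : Type*} [Fintype ι] {x : ι → ℝ} (hx : x ≠ 0) :
    0 < x ⬝ᵥ x :=
  lt_of_le_of_ne (dotProduct_self_nonneg_real x) fun h => hx (dotProduct_self_eq_zero.1 h.symm)

theorem frobenius_norm_sq {ι κ : Type*} [Fintype ι] [Fintype κ] (W : Matrix ι κ ℝ) :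
    ‖W‖ ^ 2 = ∑ i, ∑ j, W i j ^ 2 := by
  rw [Matrix.frobenius_norm_def, ← Real.rpow_natCast, ← Real.rpow_mul (by positivity)]
  simp

theorem frobenius_norm_sq_eq_trace {ι κ : Type*} [Fintype ι] [Fintype κ] (W : Matrix ι κ ℝ) :
    ‖W‖ ^ 2 = (Wᵀ * W).trace := by
  rw [frobenius_norm_sq, Finset.sum_comm]
  simp [Matrix.trace, Matrix.mul_apply, sq]

theorem abs_trace_mul_le {ι κ : Type*} [Fintype ι] [Fintype κ] (C : Matrix ι κ ℝ)
    (D : Matrix κ ι ℝ) : |(C * D).trace| ≤ ‖C‖ * ‖D‖ := by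
  have h : (C * D).trace = ∑ p : ι × κ, C p.1 p.2 * D p.2 p.1 := by
    rw [Fintype.sum_prod_type]; simp [Matrix.trace, Matrix.mul_apply]
  have hC : ‖C‖ ^ 2 = ∑ p : ι × κ, C p.1 p.2 ^ 2 := by
    rw [frobenius_norm_sq, Fintype.sum_prod_type]
  have hD : ‖D‖ ^ 2 = ∑ p : ι × κ, D p.2 p.1 ^ 2 := by
    rw [frobenius_norm_sq, Fintype.sum_prod_type, Finset.sum_comm]
  refine abs_le_of_sq_le_sq ?_ (by positivity)
  rw [mul_pow, h, hC, hD]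
  exact Finset.sum_mul_sq_le_sq_mul_sq _ _ _

theorem dotProduct_mulVec_self_le {ι κ : Type*} [Fintype ι] [Fintype κ] (W : Matrix ι κ ℝ)
    (x : κ → ℝ) : (W *ᵥ x) ⬝ᵥ (W *ᵥ x) ≤ ‖W‖ ^ 2 * (x ⬝ᵥ x) := by
  rw [frobenius_norm_sq, Finset.sum_mul]
  refine Finset.sum_le_sum fun i _ => ?_
  rw [← sq]
  refine (Finset.sum_mul_sq_le_sq_mul_sq _ _ _).trans (le_of_eq ?_)
  simp [dotProduct, sq]

theorem abs_quad_le {ι : Type*} [Fintype ι] (M : Matrix ι ι ℝ) (x : ι → ℝ) :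
    |x ⬝ᵥ (M *ᵥ x)| ≤ ‖M‖ * (x ⬝ᵥ x) := by
  have h0 := dotProduct_self_nonneg_real x
  refine abs_le_of_sq_le_sq ?_ (by positivity)
  have h1 : (x ⬝ᵥ (M *ᵥ x)) ^ 2 ≤ (x ⬝ᵥ x) * ((M *ᵥ x) ⬝ᵥ (M *ᵥ x)) := by
    refine (Finset.sum_mul_sq_le_sq_mul_sq _ _ _).trans (le_of_eq ?_)
    simp [dotProduct, sq]
  have h2 := mul_le_mul_of_nonneg_left (dotProduct_mulVec_self_le M x) h0
  nlinarith

/-- The constant is the minimum of the quadratic form on the compact Euclidean unit sphere. -/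
theorem Matrix.PosDef.exists_coercive {ι : Type*} [Fintype ι] {M : Matrix ι ι ℝ} (h : M.PosDef) :
    ∃ c : ℝ, 0 < c ∧ ∀ x : ι → ℝ, c * (x ⬝ᵥ x) ≤ x ⬝ᵥ (M *ᵥ x) := by
  let S : Set (ι → ℝ) := {x | x ⬝ᵥ x = 1}
  have hS : IsCompact S := by
    refine Metric.isCompact_of_isClosed_isBounded
      (isClosed_eq (by fun_prop) continuous_const) ?_
    refine (Metric.isBounded_iff_subset_closedBall 0).2 ⟨1, fun x hx => ?_⟩
    rw [mem_closedBall_zero_iff, pi_norm_le_iff_of_nonneg zero_le_one]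
    intro i
    have : x i * x i ≤ x ⬝ᵥ x :=
      Finset.single_le_sum (f := fun i => x i * x i) (fun j _ => mul_self_nonneg _)
        (Finset.mem_univ i)
    rw [show x ⬝ᵥ x = 1 from hx] at this
    exact abs_le_of_sq_le_sq (by nlinarith) zero_le_one
  -- The sphere is empty only if zero is the only vector; then any constant works.
  rcases S.eq_empty_or_nonempty with hE | hN
  · refine ⟨1, one_pos, fun x => ?_⟩
    by_cases hx : x = 0
    · simp [hx]
    · exfalso
      have hp := dotProduct_self_pos_real hx
      have : (√(x ⬝ᵥ x))⁻¹ • x ∈ S := by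
        simp only [S, mem_ofPred_eq, smul_dotProduct, dotProduct_smul, smul_eq_mul]
        rw [← mul_assoc, ← mul_inv, Real.mul_self_sqrt hp.le, inv_mul_cancel₀ hp.ne']
      simp [hE] at this
  · obtain ⟨y, hy, hmin⟩ := hS.exists_isMinOn hN
      (f := fun x => x ⬝ᵥ (M *ᵥ x)) (by fun_prop)
    have hy0 : y ≠ 0 := by
      rintro rfl
      simp [S] at hy
    refine ⟨_, h.quad_pos hy0, fun x => ?_⟩
    by_cases hx : x = 0
    · simp [hx]
    · have hp := dotProduct_self_pos_real hx
      have hxS : (√(x ⬝ᵥ x))⁻¹ • x ∈ S := by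
        simp only [S, mem_ofPred_eq, smul_dotProduct, dotProduct_smul, smul_eq_mul]
        rw [← mul_assoc, ← mul_inv, Real.mul_self_sqrt hp.le, inv_mul_cancel₀ hp.ne']
      have := hmin hxS
      simp only [mem_ofPred_eq, Matrix.mulVec_smul, smul_dotProduct, dotProduct_smul,
        smul_eq_mul] at this
      rw [← mul_assoc, ← mul_inv, Real.mul_self_sqrt hp.le, inv_mul_eq_div, le_div_iff₀ hp] at this
      exact this

theorem trace_mul_nonneg_of_posSemidef {ι : Type*} [Fintype ι] [DecidableEq ι]
    {C D : Matrix ι ι ℝ}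
    (hC : C.PosSemidef) (hD : D.PosSemidef) : 0 ≤ (C * D).trace := by
  open scoped MatrixOrder in
  obtain ⟨S, rfl⟩ := CStarAlgebra.nonneg_iff_eq_star_mul_self.1 hC.nonneg
  rw [Matrix.star_eq_conjTranspose, Matrix.mul_assoc, Matrix.trace_mul_comm]
  exact (hD.mul_mul_conjTranspose_same S).trace_nonneg

/-- With `D = SᵀS` this is submultiplicativity of the Frobenius norm: `tr D = ‖S‖²` and `tr D² =
‖SᵀS‖²`. -/
theorem trace_mul_self_le_sq_trace {ι : Type*} [Fintype ι] [DecidableEq ι] {D : Matrix ι ι ℝ}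
    (hD : D.PosSemidef) : (D * D).trace ≤ D.trace ^ 2 := by
  open scoped MatrixOrder in
  obtain ⟨S, hS⟩ := CStarAlgebra.nonneg_iff_eq_star_mul_self.1 hD.nonneg
  have hS' : D = Sᵀ * S := by
    rw [hS, Matrix.star_eq_conjTranspose, Matrix.conjTranspose_eq_transpose_of_trivial]
  have h1 : (D * D).trace = ‖Sᵀ * S‖ ^ 2 := by
    rw [frobenius_norm_sq_eq_trace, ← hS', hD.transpose_eq]
  have h2 : D.trace = ‖S‖ ^ 2 := by rw [frobenius_norm_sq_eq_trace, ← hS']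
  rw [h1, h2]
  have h3 := Matrix.frobenius_norm_mul Sᵀ S
  rw [Matrix.frobenius_norm_transpose, ← sq] at h3
  exact pow_le_pow_left₀ (norm_nonneg _) h3 2

theorem frobenius_norm_le_trace {ι : Type*} [Fintype ι] [DecidableEq ι] {D : Matrix ι ι ℝ}
    (hD : D.PosSemidef) : ‖D‖ ≤ D.trace := by
  refine le_of_sq_le_sq ?_ hD.trace_nonneg
  rw [frobenius_norm_sq_eq_trace, hD.transpose_eq]
  exact trace_mul_self_le_sq_trace hD
/-! ### Hurwitz matrices and the Lyapunov equation -/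

section Lyapunov

variable {n : ℕ}

theorem mem_spectrum_iff_eigenvector {n : ℕ} (M : Matrix (Fin n) (Fin n) ℂ) (μ : ℂ) :
    μ ∈ spectrum ℂ M ↔ ∃ v : Fin n → ℂ, v ≠ 0 ∧ M *ᵥ v = μ • v := by
  rw [← Matrix.spectrum_toLin', ← Module.End.hasEigenvalue_iff_mem_spectrum]
  constructor
  · intro h
    obtain ⟨v, hv⟩ := h.exists_hasEigenvector
    exact ⟨v, hv.2, by simpa using hv.apply_eq_smul⟩
  · rintro ⟨v, hv, h⟩
    exact Module.End.hasEigenvalue_of_hasEigenvector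
      (Module.End.hasEigenvector_iff.2 ⟨Module.End.mem_eigenspace_iff.2 (by simpa using h), hv⟩)

theorem IsHurwitz.transpose {F : Matrix (Fin n) (Fin n) ℝ} (h : IsHurwitz F) : IsHurwitz Fᵀ := by
  intro μ hμ
  refine h μ ?_
  rw [Matrix.mem_spectrum_iff_isRoot_charpoly] at hμ ⊢
  rwa [← Matrix.charpoly_transpose, ← Matrix.transpose_map]

/-- The equation intertwines `F` with `-Fᵀ`, hence `P p(F) = p(-Fᵀ) P` for every polynomial `p`. For
`p` the characteristic polynomial of `F` the left side vanishes, while `p(-Fᵀ)` is invertible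
because the spectra of `F` and `-Fᵀ` lie in opposite open half-planes. -/
theorem eq_zero_of_sylvester {F P : Matrix (Fin n) (Fin n) ℝ} (hF : IsHurwitz F)
    (h : Fᵀ * P + P * F = 0) : P = 0 := by
  rcases Nat.eq_zero_or_pos n with rfl | hn
  · exact Subsingleton.elim _ _
  have : Nonempty (Fin n) := ⟨⟨0, hn⟩⟩
  set Fc := F.map (algebraMap ℝ ℂ) with hFc
  set Gc := (-Fᵀ).map (algebraMap ℝ ℂ) with hGc
  set Pc := P.map (algebraMap ℝ ℂ) with hPc
  have hcomm : Pc * Fc = Gc * Pc := by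
    rw [hPc, hFc, hGc, ← Matrix.map_mul, ← Matrix.map_mul, Matrix.neg_mul,
      eq_neg_of_add_eq_zero_right h]
  have hpow : ∀ p : Polynomial ℂ, Pc * Polynomial.aeval Fc p = Polynomial.aeval Gc p * Pc := by
    intro p
    induction p using Polynomial.induction_on' with
    | add p q hp hq => simp only [map_add, mul_add, add_mul, hp, hq]
    | monomial k a =>
      have : ∀ k : ℕ, Pc * Fc ^ k = Gc ^ k * Pc := by
        intro k
        induction k with
        | zero => simp
        | succ k ih => rw [pow_succ, ← mul_assoc, ih, mul_assoc, hcomm, ← mul_assoc, ← pow_succ]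
      rw [Polynomial.aeval_monomial, Polynomial.aeval_monomial, ← Algebra.smul_def,
        ← Algebra.smul_def, mul_smul_comm, this, smul_mul_assoc]
  have hu : IsUnit (Polynomial.aeval Gc Fc.charpoly) := by
    by_contra hnu
    rw [← spectrum.zero_mem_iff ℂ, spectrum.map_polynomial_aeval_of_degree_pos] at hnu
    · obtain ⟨μ, hμ, h0⟩ := hnu
      have h1 : μ ∈ spectrum ℂ Fc := Matrix.mem_spectrum_iff_isRoot_charpoly.2 h0
      have h2 : -μ ∈ spectrum ℂ (Fᵀ.map (algebraMap ℝ ℂ)) := by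
        have : Gc = -(Fᵀ.map (algebraMap ℝ ℂ)) := by ext i j; simp [hGc]
        rw [this, ← spectrum.neg_eq] at hμ
        simpa using hμ
      have h3 := hF μ h1
      have h4 := hF.transpose _ h2
      simp at h4
      linarith
    · rw [Matrix.charpoly_degree_eq_dim]
      simpa using hn
  have h0 : Polynomial.aeval Gc Fc.charpoly * Pc = 0 := by
    rw [← hpow, Matrix.aeval_self_charpoly, mul_zero]
  have : Pc = 0 := (hu.mul_right_eq_zero).1 h0
  ext i j
  have := congr_fun (congr_fun this i) j
  simpa [hPc] using this

theorem dotProduct_transpose_mulVec (F : Matrix (Fin n) (Fin n) ℝ) (x y : Fin n → ℝ) :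
    x ⬝ᵥ (Fᵀ *ᵥ y) = (F *ᵥ x) ⬝ᵥ y := by
  rw [Matrix.mulVec_transpose, dotProduct_comm, ← Matrix.dotProduct_mulVec, dotProduct_comm]

theorem dotProduct_mulVec_comm_of_symm {P : Matrix (Fin n) (Fin n) ℝ} (hP : Pᵀ = P)
    (x y : Fin n → ℝ) : x ⬝ᵥ (P *ᵥ y) = y ⬝ᵥ (P *ᵥ x) := by
  conv_lhs => rw [← hP]
  rw [dotProduct_transpose_mulVec, dotProduct_comm]

theorem quad_lyapunov {F P : Matrix (Fin n) (Fin n) ℝ} (hP : Pᵀ = P) (x : Fin n → ℝ) :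
    x ⬝ᵥ ((Fᵀ * P + P * F) *ᵥ x) = 2 * (x ⬝ᵥ (P *ᵥ (F *ᵥ x))) := by
  rw [Matrix.add_mulVec, dotProduct_add, ← Matrix.mulVec_mulVec, ← Matrix.mulVec_mulVec,
    dotProduct_transpose_mulVec, dotProduct_mulVec_comm_of_symm hP (F *ᵥ x)]
  ring

/-- For an eigenvector `x + iy`, adding the quadratic forms at `x` and `y` cancels the terms with
`Im μ` and leaves `-2 Re μ (xᵀPx + yᵀPy) > 0`. -/
theorem isHurwitz_of_lyapunov {F P : Matrix (Fin n) (Fin n) ℝ} (hP : P.PosDef)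
    (h : (-(Fᵀ * P + P * F)).PosDef) : IsHurwitz F := by
  intro μ hμ
  obtain ⟨v, hv, hFv⟩ := (mem_spectrum_iff_eigenvector _ _).1 hμ
  set x : Fin n → ℝ := fun i => (v i).re with hx
  set y : Fin n → ℝ := fun i => (v i).im with hy
  have hFx : F *ᵥ x = μ.re • x - μ.im • y := by
    ext i
    have := congr_arg Complex.re (congr_fun hFv i)
    simpa [Matrix.mulVec, dotProduct, hx, hy, Complex.mul_re] using this
  have hFy : F *ᵥ y = μ.im • x + μ.re • y := by
    ext i
    have := congr_arg Complex.im (congr_fun hFv i)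
    simp [Matrix.mulVec, dotProduct, hx, hy, Complex.mul_im] at this ⊢
    linarith
  have hxy : x ≠ 0 ∨ y ≠ 0 := by
    by_contra hcon
    push Not at hcon
    refine hv (funext fun i => Complex.ext ?_ ?_)
    · exact congr_fun hcon.1 i
    · exact congr_fun hcon.2 i
  have hsym := dotProduct_mulVec_comm_of_symm hP.transpose_eq y x
  have hqx := h.posSemidef.quad_nonneg x
  have hqy := h.posSemidef.quad_nonneg y
  have hpx := hP.posSemidef.quad_nonneg x
  have hpy := hP.posSemidef.quad_nonneg y
  have ex : x ⬝ᵥ ((-(Fᵀ * P + P * F)) *ᵥ x)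
      = -2 * (μ.re * (x ⬝ᵥ (P *ᵥ x)) - μ.im * (x ⬝ᵥ (P *ᵥ y))) := by
    rw [Matrix.neg_mulVec, dotProduct_neg, quad_lyapunov hP.transpose_eq, hFx, Matrix.mulVec_sub,
      Matrix.mulVec_smul, Matrix.mulVec_smul, dotProduct_sub, dotProduct_smul, dotProduct_smul]
    simp only [smul_eq_mul]; ring
  have ey : y ⬝ᵥ ((-(Fᵀ * P + P * F)) *ᵥ y)
      = -2 * (μ.im * (x ⬝ᵥ (P *ᵥ y)) + μ.re * (y ⬝ᵥ (P *ᵥ y))) := by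
    rw [Matrix.neg_mulVec, dotProduct_neg, quad_lyapunov hP.transpose_eq, hFy, Matrix.mulVec_add,
      Matrix.mulVec_smul, Matrix.mulVec_smul, dotProduct_add, dotProduct_smul, dotProduct_smul,
      hsym]
    simp only [smul_eq_mul]; ring
  have hsum : 0 < -2 * μ.re * (x ⬝ᵥ (P *ᵥ x) + y ⬝ᵥ (P *ᵥ y)) := by
    rcases hxy with hx0 | hy0
    · have := h.quad_pos hx0
      nlinarith
    · have := h.quad_pos hy0
      nlinarith
  by_contra hneg
  push Not at hneg
  nlinarith [mul_nonneg hneg (add_nonneg hpx hpy)]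

/-- The Lyapunov operator `P ↦ Fᵀ P + P F`. -/
def lyapunovOp (F : Matrix (Fin n) (Fin n) ℝ) :
    Matrix (Fin n) (Fin n) ℝ →ₗ[ℝ] Matrix (Fin n) (Fin n) ℝ where
  toFun P := Fᵀ * P + P * F
  map_add' P Q := by rw [Matrix.mul_add, Matrix.add_mul]; abel
  map_smul' c P := by simp

@[simp] theorem lyapunovOp_apply (F P : Matrix (Fin n) (Fin n) ℝ) :
    lyapunovOp F P = Fᵀ * P + P * F := rfl

theorem IsHurwitz.injective_lyapunovOp {F : Matrix (Fin n) (Fin n) ℝ} (hF : IsHurwitz F) :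
    Function.Injective (lyapunovOp F) :=
  (injective_iff_map_eq_zero _).2 fun _ hP => eq_zero_of_sylvester hF hP

theorem IsHurwitz.lyapunovSol_spec {F : Matrix (Fin n) (Fin n) ℝ} (hF : IsHurwitz F)
    (M : Matrix (Fin n) (Fin n) ℝ) :
    Fᵀ * lyapunovSol F M + lyapunovSol F M * F = -M := by
  have hex : ∃ P : Matrix (Fin n) (Fin n) ℝ, Fᵀ * P + P * F + M = 0 := by
    obtain ⟨P, hP⟩ := LinearMap.injective_iff_surjective.1 hF.injective_lyapunovOp (-M)
    exact ⟨P, by rw [← lyapunovOp_apply, hP, neg_add_cancel]⟩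
  rw [lyapunovSol, dif_pos hex]
  exact eq_neg_of_add_eq_zero_left hex.choose_spec

theorem IsHurwitz.eq_lyapunovSol {F : Matrix (Fin n) (Fin n) ℝ} (hF : IsHurwitz F)
    {M P : Matrix (Fin n) (Fin n) ℝ} (h : Fᵀ * P + P * F = -M) : P = lyapunovSol F M :=
  hF.injective_lyapunovOp (h.trans (hF.lyapunovSol_spec M).symm)

/-- The solution is `T(x)⁻¹ f(x)`, and inversion is continuous on the units of the Banach algebra of
endomorphisms. -/
theorem continuousOn_solution_of_injective {E X : Type*} [NormedAddCommGroup E] [NormedSpace ℝ E]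
    [FiniteDimensional ℝ E] [TopologicalSpace X] {T : X → E →ₗ[ℝ] E} {f u : X → E} {S : Set X}
    (hT : ∀ v, Continuous fun x => T x v) (hf : Continuous f)
    (hinj : ∀ x ∈ S, Function.Injective (T x)) (hu : ∀ x ∈ S, T x (u x) = f x) :
    ContinuousOn u S := by
  let L : X → E →L[ℝ] E := fun x => LinearMap.toContinuousLinearMap (T x)
  have hL : Continuous L := continuous_clm_apply.2 hT
  have : CompleteSpace E := FiniteDimensional.complete ℝ E
  have hunit : ∀ x ∈ S, IsUnit (L x) := by
    intro x hx
    refine ⟨ContinuousLinearEquiv.toUnit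
      (LinearEquiv.ofInjectiveEndo (T x) (hinj x hx)).toContinuousLinearEquiv, ?_⟩
    ext1 v
    rfl
  have h : ContinuousOn (fun x => Ring.inverse (L x) (f x)) S := by
    intro x hx
    obtain ⟨w, hw⟩ := hunit x hx
    have h1 := NormedRing.inverse_continuousAt w
    rw [hw] at h1
    have h2 : ContinuousAt (fun y => Ring.inverse (L y)) x :=
      ContinuousAt.comp (f := L) h1 hL.continuousAt
    exact (h2.clm_apply hf.continuousAt).continuousWithinAt
  refine h.congr fun x hx => ?_
  have h3 := congr_arg (fun R => R (u x)) (Ring.inverse_mul_cancel _ (hunit x hx))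
  simp only [mul_apply_eq_comp, one_apply_eq_self] at h3
  change u x = Ring.inverse (L x) (f x)
  rw [← hu x hx]
  exact h3.symm

theorem continuousOn_lyapunovSol :
    ContinuousOn (fun p : Matrix (Fin n) (Fin n) ℝ × Matrix (Fin n) (Fin n) ℝ =>
      lyapunovSol p.1 p.2) {p | IsHurwitz p.1} := by
  refine continuousOn_solution_of_injective (E := Matrix (Fin n) (Fin n) ℝ)
    (T := fun p : Matrix (Fin n) (Fin n) ℝ × Matrix (Fin n) (Fin n) ℝ => lyapunovOp p.1)
    (f := fun p => -p.2) (fun v => ?_) ?_ (fun p hp => IsHurwitz.injective_lyapunovOp hp)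
    (fun p hp => IsHurwitz.lyapunovSol_spec hp _)
  · have : Continuous fun p : Matrix (Fin n) (Fin n) ℝ × Matrix (Fin n) (Fin n) ℝ =>
      p.1ᵀ * v + v * p.1 := by fun_prop
    exact this
  · have : Continuous fun p : Matrix (Fin n) (Fin n) ℝ × Matrix (Fin n) (Fin n) ℝ => -p.2 := by
      fun_prop
    exact this

theorem IsHurwitz.lyapunovSol_transpose {F : Matrix (Fin n) (Fin n) ℝ} (hF : IsHurwitz F)
    {M : Matrix (Fin n) (Fin n) ℝ} (hM : Mᵀ = M) :
    (lyapunovSol F M)ᵀ = lyapunovSol F M := by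
  refine hF.eq_lyapunovSol ?_
  have := congr_arg Matrix.transpose (hF.lyapunovSol_spec M)
  simpa [hM, add_comm] using this

/-- A null vector of the form `P` lies in the kernel of `P`, and there the left side of the equation
has zero quadratic form, contradicting `M > 0`. So semidefiniteness, a closed condition, improves
itself to definiteness, an open one. -/
theorem posDef_of_posSemidef_lyapunov {F P M : Matrix (Fin n) (Fin n) ℝ} (hP : P.PosSemidef)
    (hM : M.PosDef) (h : Fᵀ * P + P * F = -M) : P.PosDef := by
  refine posDef_real_iff.2 ⟨hP.transpose_eq, fun x hx => ?_⟩
  refine lt_of_le_of_ne (hP.quad_nonneg x) fun h0 => ?_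
  have hPx : P *ᵥ x = 0 := by
    open scoped MatrixOrder in
    refine (hP.dotProduct_mulVec_zero_iff x).1 ?_
    simpa using h0.symm
  have h1 := hM.quad_pos hx
  have h2 : x ⬝ᵥ ((-M) *ᵥ x) = 0 := by
    rw [← h, quad_lyapunov hP.transpose_eq, dotProduct_mulVec_comm_of_symm hP.transpose_eq, hPx]
    simp
  rw [Matrix.neg_mulVec, dotProduct_neg] at h2
  linarith

theorem isClosed_posSemidef : IsClosed {P : Matrix (Fin n) (Fin n) ℝ | P.PosSemidef} := by
  have : {P : Matrix (Fin n) (Fin n) ℝ | P.PosSemidef} =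
      {P | Pᵀ = P} ∩ ⋂ x : Fin n → ℝ, {P | 0 ≤ x ⬝ᵥ (P *ᵥ x)} := by
    ext P; simp [posSemidef_real_iff]
  rw [this]
  refine (isClosed_eq (by fun_prop) continuous_id).inter (isClosed_iInter fun x => ?_)
  exact isClosed_le continuous_const (by fun_prop)

theorem Matrix.PosDef.of_norm_sub_lt {P P' : Matrix (Fin n) (Fin n) ℝ} {c : ℝ}
    (hc : ∀ x : Fin n → ℝ, c * (x ⬝ᵥ x) ≤ x ⬝ᵥ (P *ᵥ x)) (hs : P'ᵀ = P') (h : ‖P' - P‖ < c) :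
    P'.PosDef := by
  refine posDef_real_iff.2 ⟨hs, fun x hx => ?_⟩
  have h1 := (abs_le.1 (abs_quad_le (P' - P) x)).1
  rw [Matrix.sub_mulVec, dotProduct_sub] at h1
  have h2 := hc x
  have h3 := mul_lt_mul_of_pos_right h (dotProduct_self_pos_real hx)
  linarith

theorem isHurwitz_segment {F : Matrix (Fin n) (Fin n) ℝ} (hF : IsHurwitz F) {t : ℝ}
    (h0 : 0 ≤ t) (h1 : t ≤ 1) : IsHurwitz ((1 - t) • F - t • 1) := by
  intro μ hμ
  obtain ⟨v, hv, hFv⟩ := (mem_spectrum_iff_eigenvector _ _).1 hμ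
  have hmap : ((1 - t) • F - t • (1 : Matrix (Fin n) (Fin n) ℝ)).map (algebraMap ℝ ℂ)
      = ((1 - t : ℝ) : ℂ) • F.map (algebraMap ℝ ℂ) - (t : ℂ) • 1 := by
    ext i j
    by_cases hij : i = j <;> simp [hij]
  have hv' : ((1 - t : ℝ) : ℂ) • (F.map (algebraMap ℝ ℂ) *ᵥ v) = (μ + t) • v := by
    rw [hmap, Matrix.sub_mulVec, Matrix.smul_mulVec, Matrix.smul_mulVec,
      Matrix.one_mulVec] at hFv
    rw [add_smul, ← hFv, sub_add_cancel]
  rcases h1.lt_or_eq with h1 | h1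
  · have hne : ((1 - t : ℝ) : ℂ) ≠ 0 := by
      exact_mod_cast (sub_pos.2 h1).ne'
    have := hF (((1 - t : ℝ) : ℂ)⁻¹ * (μ + t)) ((mem_spectrum_iff_eigenvector _ _).2 ⟨v, hv, by
      rw [mul_smul, ← hv', smul_smul, inv_mul_cancel₀ hne, one_smul]⟩)
    rw [← Complex.ofReal_inv, Complex.re_ofReal_mul] at this
    have h2 := sub_pos.2 h1
    have h3 : (μ + t).re < 0 := by
      by_contra hc
      push Not at hc
      exact absurd this (not_lt.2 (mul_nonneg (inv_nonneg.2 h2.le) hc))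
    simp at h3
    linarith
  · subst h1
    have h4 : (μ + (1 : ℝ)) • v = 0 := by rw [← hv']; simp
    have h5 : μ + (1 : ℝ) = 0 := (smul_eq_zero.1 h4).resolve_right hv
    have := congr_arg Complex.re h5
    simp at this
    linarith

/-- Continuation along the Hurwitz segment from `-I`, where the solution is `M/2`, to `F`. The
parameters with semidefinite solution form a closed set, which is also open to the right by
`posDef_of_posSemidef_lyapunov` and continuity. -/
theorem IsHurwitz.lyapunovSol_posDef {F : Matrix (Fin n) (Fin n) ℝ} (hF : IsHurwitz F)
    {M : Matrix (Fin n) (Fin n) ℝ} (hM : M.PosDef) : (lyapunovSol F M).PosDef := by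
  let G : ℝ → Matrix (Fin n) (Fin n) ℝ := fun t => (1 - t) • F - t • 1
  let P : ℝ → Matrix (Fin n) (Fin n) ℝ := fun t => lyapunovSol (G t) M
  have hG : ∀ t ∈ Icc (0 : ℝ) 1, IsHurwitz (G t) := fun t ht => isHurwitz_segment hF ht.1 ht.2
  have hPc : ContinuousOn P (Icc 0 1) := by
    refine continuousOn_lyapunovSol.comp (f := fun t => (G t, M)) (Continuous.continuousOn ?_) hG
    exact Continuous.prodMk (by fun_prop) continuous_const
  have hup : ∀ t ∈ Icc (0 : ℝ) 1, (P t).PosSemidef → (P t).PosDef := fun t ht h =>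
    posDef_of_posSemidef_lyapunov h hM ((hG t ht).lyapunovSol_spec M)
  -- Time is reversed so that the induction over the interval starts at `-I` and ends at `F`.
  let Q : ℝ → Prop := fun t => (P (1 - t)).PosSemidef
  have hmaps : MapsTo (fun t : ℝ => 1 - t) (Icc 0 1) (Icc 0 1) := fun t ht =>
    ⟨by linarith [ht.2], by linarith [ht.1]⟩
  have hsub : Icc (0 : ℝ) 1 ⊆ {t | Q t} := by
    refine IsClosed.Icc_subset_of_forall_mem_nhdsWithin (a := (0 : ℝ)) (b := 1) ?_ ?_ ?_
    · have h2 : ContinuousOn (fun t : ℝ => P (1 - t)) (Icc 0 1) :=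
        hPc.comp (by fun_prop) hmaps
      rw [inter_comm]
      exact h2.preimage_isClosed_of_isClosed isClosed_Icc isClosed_posSemidef
    · have : P 1 = (1 / 2 : ℝ) • M := by
        refine ((hG 1 (by simp)).eq_lyapunovSol ?_).symm
        simp only [G, sub_self, zero_smul, one_smul, zero_sub, Matrix.transpose_neg,
          Matrix.transpose_one, Matrix.neg_mul, Matrix.one_mul, Matrix.mul_neg, Matrix.mul_one]
        rw [← neg_add, ← add_smul]
        norm_num
      simp only [Q, mem_ofPred_eq, sub_zero, this]
      exact hM.posSemidef.smul (by norm_num)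
    · rintro t ⟨hQt, ht⟩
      have ht' : 1 - t ∈ Icc (0 : ℝ) 1 := hmaps ⟨ht.1, ht.2.le⟩
      obtain ⟨c, hc, hcP⟩ := (hup _ ht' hQt).exists_coercive
      have h2 : ContinuousOn (fun t : ℝ => P (1 - t)) (Icc 0 1) :=
        hPc.comp (by fun_prop) hmaps
      have h3 := h2 t ⟨ht.1, ht.2.le⟩
      have h4 : ∀ᶠ s in 𝓝[Icc 0 1] t, ‖P (1 - s) - P (1 - t)‖ < c := by
        have := (Metric.tendsto_nhds.1 h3) c hc
        simpa [dist_eq_norm] using this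
      have h5 : 𝓝[>] t ≤ 𝓝[Icc 0 1] t := by
        refine nhdsWithin_le_of_mem ?_
        exact mem_of_superset (Ioc_mem_nhdsGT ht.2) fun s hs => ⟨ht.1.trans hs.1.le, hs.2⟩
      filter_upwards [h5 h4, h5 self_mem_nhdsWithin] with s hs hsI
      exact (Matrix.PosDef.of_norm_sub_lt hcP
        ((hG _ (hmaps hsI)).lyapunovSol_transpose hM.transpose_eq) hs).posSemidef
  have h1 : Q 1 := hsub (by simp)
  have h2 : P 0 = lyapunovSol F M := by simp [P, G]
  rw [← h2]
  have h3 : (P 0).PosSemidef := by simpa [Q] using h1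
  exact hup 0 (by simp) h3

theorem IsHurwitz.lyapunovSol_posSemidef {F : Matrix (Fin n) (Fin n) ℝ} (hF : IsHurwitz F)
    {M : Matrix (Fin n) (Fin n) ℝ} (hM : M.PosSemidef) : (lyapunovSol F M).PosSemidef := by
  have h1 : ContinuousOn (fun t : ℝ => lyapunovSol F (M + t • 1)) (Ici 0) :=
    continuousOn_lyapunovSol.comp (f := fun t : ℝ => (F, M + t • (1 : Matrix (Fin n) (Fin n) ℝ)))
      (Continuous.continuousOn (Continuous.prodMk continuous_const (by fun_prop)))
      (fun _ _ => hF)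
  have h2 : Tendsto (fun t : ℝ => lyapunovSol F (M + t • 1)) (𝓝[>] 0) (𝓝 (lyapunovSol F M)) := by
    have := (h1 0 (by simp)).mono_left (nhdsWithin_mono 0 Ioi_subset_Ici_self)
    simpa using this
  refine isClosed_posSemidef.mem_of_tendsto h2 ?_
  filter_upwards [self_mem_nhdsWithin] with t ht
  exact (hF.lyapunovSol_posDef (Matrix.PosDef.posSemidef_add hM (Matrix.PosDef.one.smul ht))).posSemidef

theorem posSemidef_of_lyapunov {F P M : Matrix (Fin n) (Fin n) ℝ} (hF : IsHurwitz F)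
    (hM : M.PosSemidef) (h : Fᵀ * P + P * F = -M) : P.PosSemidef := by
  rw [hF.eq_lyapunovSol h]
  exact hF.lyapunovSol_posSemidef hM

/-- The solution `P` for `F` with right-hand side `-I` remains a Lyapunov certificate for all nearby
matrices. -/
theorem isOpen_isHurwitz : IsOpen {F : Matrix (Fin n) (Fin n) ℝ | IsHurwitz F} := by
  rw [isOpen_iff_mem_nhds]
  intro F hF
  have hF' : IsHurwitz F := hF
  set P := lyapunovSol F 1 with hPdef
  have hP : P.PosDef := hF'.lyapunovSol_posDef Matrix.PosDef.one
  have hspec := hF'.lyapunovSol_spec 1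
  have hcont : Continuous fun G : Matrix (Fin n) (Fin n) ℝ => -(Gᵀ * P + P * G) := by fun_prop
  have h1 := Metric.tendsto_nhds.1 (hcont.tendsto F) 1 one_pos
  filter_upwards [h1] with G hG
  refine isHurwitz_of_lyapunov hP (Matrix.PosDef.of_norm_sub_lt (P := 1) (c := 1) ?_ ?_ ?_)
  · intro x; simp
  · simp [hP.transpose_eq, add_comm]
  · rw [dist_eq_norm, hspec, neg_neg] at hG
    exact hG

/-- The trace of a Lyapunov solution in terms of the dual Lyapunov equation. -/
theorem trace_eq_trace_gramian_mul {F Y D N : Matrix (Fin n) (Fin n) ℝ}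
    (hY : F * Y + Y * Fᵀ = -1) (hD : Fᵀ * D + D * F = -N) : D.trace = (Y * N).trace := by
  have h1 : (D * (F * Y + Y * Fᵀ)).trace = ((Fᵀ * D + D * F) * Y).trace := by
    rw [Matrix.mul_add, Matrix.add_mul, Matrix.trace_add, Matrix.trace_add, add_comm]
    congr 1
    · rw [← Matrix.mul_assoc, Matrix.trace_mul_comm, ← Matrix.mul_assoc]
    · rw [Matrix.mul_assoc]
  rw [hY, hD] at h1
  rw [Matrix.trace_mul_comm Y N]
  simpa using h1

end Lyapunov
/-! ### Algebra of the linear quadratic regulator -/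

section LQR

variable {n m : ℕ} {A : Matrix (Fin n) (Fin n) ℝ} {B : Matrix (Fin n) (Fin m) ℝ}
  {Q : Matrix (Fin n) (Fin n) ℝ} {R : Matrix (Fin m) (Fin m) ℝ}

theorem Matrix.PosDef.mul_gainOf (hR : R.PosDef) (X : Matrix (Fin n) (Fin n) ℝ) :
    R * gainOf B R X = Bᵀ * X := by
  have := (Matrix.isUnit_iff_isUnit_det R).1 hR.isUnit
  rw [gainOf, Matrix.mul_assoc, Matrix.mul_nonsing_inv_cancel_left _ _ this]

theorem Matrix.PosDef.gainOf_transpose_mul (hR : R.PosDef) {X : Matrix (Fin n) (Fin n) ℝ}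
    (hX : Xᵀ = X) : (gainOf B R X)ᵀ * R = X * B := by
  have := congr_arg Matrix.transpose (hR.mul_gainOf (B := B) X)
  simpa [Matrix.transpose_mul, hR.transpose_eq, hX] using this

/-- Changing the gain in the Lyapunov expression of a cost matrix. -/
theorem lyapunov_change_gain (hR : R.PosDef) {K : Matrix (Fin m) (Fin n) ℝ}
    {P : Matrix (Fin n) (Fin n) ℝ} (hP : Pᵀ = P)
    (h : (A - B * K)ᵀ * P + P * (A - B * K) = -(Q + Kᵀ * R * K)) (K' : Matrix (Fin m) (Fin n) ℝ) :
    (A - B * K')ᵀ * P + P * (A - B * K') = -(Q + K'ᵀ * R * K') +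
      ((K - K')ᵀ * R * (K - K') - (K - K')ᵀ * R * (K - gainOf B R P) -
        (K - gainOf B R P)ᵀ * R * (K - K')) := by
  have h1 := hR.mul_gainOf (B := B) P
  have h2 := hR.gainOf_transpose_mul (B := B) hP
  have h3 : Aᵀ * P + P * A =
      -(Q + Kᵀ * R * K) + Kᵀ * (Bᵀ * P) + (P * B) * K := by
    rw [← h]
    simp only [Matrix.transpose_sub, Matrix.transpose_mul, Matrix.sub_mul, Matrix.mul_sub,
      Matrix.mul_assoc]
    abel
  have h4 : (A - B * K')ᵀ * P + P * (A - B * K') =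
      (Aᵀ * P + P * A) - K'ᵀ * (Bᵀ * P) - (P * B) * K' := by
    simp only [Matrix.transpose_sub, Matrix.transpose_mul, Matrix.sub_mul, Matrix.mul_sub,
      Matrix.mul_assoc]
    abel
  rw [h4, h3, ← h1, ← h2]
  simp only [Matrix.transpose_sub, Matrix.sub_mul, Matrix.mul_sub, Matrix.mul_assoc]
  abel

/-- Since `R · gainOf B R X = BᵀX`, the Riccati residual of `X` is the Lyapunov residual at the gain
of `X`. This links Riccati zeros to cost matrices and, later, Newton steps to policy evaluation. -/
theorem riccati_eq_lyapunov (hR : R.PosDef) {X : Matrix (Fin n) (Fin n) ℝ} (hX : Xᵀ = X) :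
    riccati A B Q R X = (A - B * gainOf B R X)ᵀ * X + X * (A - B * gainOf B R X) +
      (Q + (gainOf B R X)ᵀ * R * gainOf B R X) := by
  have h1 := hR.mul_gainOf (B := B) X
  have h2 := hR.gainOf_transpose_mul (B := B) hX
  have h3 : X * B * R⁻¹ * Bᵀ * X = X * B * gainOf B R X := by
    simp only [gainOf, Matrix.mul_assoc]
  rw [riccati, h3]
  simp only [Matrix.transpose_sub, Matrix.transpose_mul, Matrix.sub_mul, Matrix.mul_sub,
    Matrix.mul_assoc, ← h1]
  simp only [← Matrix.mul_assoc, ← h2]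
  abel

theorem stageCost_posDef (hQ : Q.PosDef) (hR : R.PosDef) (K : Matrix (Fin m) (Fin n) ℝ) :
    (Q + Kᵀ * R * K).PosDef :=
  hQ.add_posSemidef (hR.posSemidef.transpose_mul_mul_same K)

theorem costMatrix_spec {K : Matrix (Fin m) (Fin n) ℝ} (hK : K ∈ stabilizing A B) :
    (A - B * K)ᵀ * costMatrix A B Q R K + costMatrix A B Q R K * (A - B * K) =
      -(Q + Kᵀ * R * K) :=
  IsHurwitz.lyapunovSol_spec hK _

theorem costMatrix_posDef (hQ : Q.PosDef) (hR : R.PosDef) {K : Matrix (Fin m) (Fin n) ℝ}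
    (hK : K ∈ stabilizing A B) : (costMatrix A B Q R K).PosDef :=
  IsHurwitz.lyapunovSol_posDef hK (stageCost_posDef hQ hR K)

theorem gramian_spec {K : Matrix (Fin m) (Fin n) ℝ} (hK : K ∈ stabilizing A B) :
    (A - B * K) * gramian A B K + gramian A B K * (A - B * K)ᵀ = -1 := by
  have h : IsHurwitz (A - B * K) := hK
  have := h.transpose.lyapunovSol_spec 1
  rwa [Matrix.transpose_transpose] at this

theorem gramian_posDef {K : Matrix (Fin m) (Fin n) ℝ} (hK : K ∈ stabilizing A B) :
    (gramian A B K).PosDef :=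
  IsHurwitz.lyapunovSol_posDef (IsHurwitz.transpose hK) Matrix.PosDef.one

theorem lyapunov_costMatrix_sub (hQ : Q.PosDef) (hR : R.PosDef) {K K' : Matrix (Fin m) (Fin n) ℝ}
    (hK : K ∈ stabilizing A B) (hK' : K' ∈ stabilizing A B) :
    (A - B * K')ᵀ * (costMatrix A B Q R K - costMatrix A B Q R K') +
      (costMatrix A B Q R K - costMatrix A B Q R K') * (A - B * K') =
      (K - K')ᵀ * R * (K - K') - (K - K')ᵀ * R * (K - gainOf B R (costMatrix A B Q R K)) -
        (K - gainOf B R (costMatrix A B Q R K))ᵀ * R * (K - K') := by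
  rw [Matrix.mul_sub, Matrix.sub_mul, sub_add_sub_comm,
    lyapunov_change_gain hR (costMatrix_posDef hQ hR hK).transpose_eq (costMatrix_spec hK) K',
    costMatrix_spec hK', add_sub_cancel_left]

/-! ### Weighted inner products of gains -/

theorem innerY_mul_eq_trace (hR : R.PosDef) (Y : Matrix (Fin n) (Fin n) ℝ)
    (K L : Matrix (Fin m) (Fin n) ℝ) : innerY Y K (R * L) = (Y * (Lᵀ * R * K)).trace := by
  rw [innerY, Matrix.transpose_mul, hR.transpose_eq, Matrix.mul_assoc, Matrix.trace_mul_comm,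
    Matrix.mul_assoc]

theorem innerY_mul_comm (hR : R.PosDef) {Y : Matrix (Fin n) (Fin n) ℝ} (hY : Yᵀ = Y)
    (K L : Matrix (Fin m) (Fin n) ℝ) : innerY Y K (R * L) = innerY Y L (R * K) := by
  rw [innerY_mul_eq_trace hR, innerY_mul_eq_trace hR, ← Matrix.trace_transpose,
    Matrix.trace_mul_comm Y]
  simp [Matrix.transpose_mul, hR.transpose_eq, hY, Matrix.mul_assoc]

theorem innerY_mul_add_smul (hR : R.PosDef) {Y : Matrix (Fin n) (Fin n) ℝ} (hY : Yᵀ = Y)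
    (K L : Matrix (Fin m) (Fin n) ℝ) (t : ℝ) :
    innerY Y (K + t • L) (R * (K + t • L)) =
      innerY Y K (R * K) + 2 * t * innerY Y K (R * L) + t ^ 2 * innerY Y L (R * L) := by
  have h : innerY Y (K + t • L) (R * (K + t • L)) = innerY Y K (R * K) + t * innerY Y K (R * L) +
      t * innerY Y L (R * K) + t * (t * innerY Y L (R * L)) := by
    simp [innerY, Matrix.mul_add, Matrix.add_mul, Matrix.trace_add, Matrix.trace_smul]
    ring
  rw [h, innerY_mul_comm hR hY L K]
  ring

theorem innerY_add_right (Y : Matrix (Fin n) (Fin n) ℝ) (K L L' : Matrix (Fin m) (Fin n) ℝ) :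
    innerY Y K (R * (L + L')) = innerY Y K (R * L) + innerY Y K (R * L') := by
  simp [innerY, Matrix.mul_add, Matrix.trace_add]

theorem Matrix.PosDef.exists_sub_smul_one {ι : Type*} [Fintype ι] [DecidableEq ι]
    {M : Matrix ι ι ℝ} (h : M.PosDef) : ∃ c : ℝ, 0 < c ∧ (M - c • 1).PosSemidef := by
  obtain ⟨c, hc, hM⟩ := h.exists_coercive
  refine ⟨c, hc, posSemidef_real_iff.2 ⟨by simp [h.transpose_eq], fun x => ?_⟩⟩
  simpa [Matrix.sub_mulVec, Matrix.smul_mulVec] using hM x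

theorem innerY_mul_self_nonneg (hR : R.PosDef) {Y : Matrix (Fin n) (Fin n) ℝ} (hY : Y.PosSemidef)
    (K : Matrix (Fin m) (Fin n) ℝ) : 0 ≤ innerY Y K (R * K) := by
  rw [innerY_mul_eq_trace hR]
  exact trace_mul_nonneg_of_posSemidef hY (hR.posSemidef.transpose_mul_mul_same K)

theorem exists_lower_bound_trace (hR : R.PosDef) : ∃ r : ℝ, 0 < r ∧
    ∀ K : Matrix (Fin m) (Fin n) ℝ, r * ‖K‖ ^ 2 ≤ (Kᵀ * R * K).trace := by
  obtain ⟨r, hr, h⟩ := hR.exists_sub_smul_one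
  refine ⟨r, hr, fun K => ?_⟩
  have := (h.transpose_mul_mul_same K).trace_nonneg
  rw [frobenius_norm_sq_eq_trace]
  simp [Matrix.mul_sub, Matrix.sub_mul, Matrix.trace_sub, Matrix.trace_smul] at this
  linarith

theorem exists_lower_bound_innerY (hR : R.PosDef) {Y : Matrix (Fin n) (Fin n) ℝ} (hY : Y.PosDef) :
    ∃ r : ℝ, 0 < r ∧ ∀ K : Matrix (Fin m) (Fin n) ℝ, r * ‖K‖ ^ 2 ≤ innerY Y K (R * K) := by
  obtain ⟨r, hr, h⟩ := exists_lower_bound_trace (n := n) hR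
  obtain ⟨y, hy, hY'⟩ := hY.exists_sub_smul_one
  refine ⟨y * r, by positivity, fun K => ?_⟩
  have h1 := trace_mul_nonneg_of_posSemidef hY' (hR.posSemidef.transpose_mul_mul_same K)
  rw [innerY_mul_eq_trace hR]
  simp only [Matrix.sub_mul, Matrix.trace_sub, Matrix.smul_mul, Matrix.one_mul,
    Matrix.trace_smul, smul_eq_mul] at h1
  have h2 := mul_le_mul_of_nonneg_left (h K) hy.le
  linarith

theorem innerY_mul_self_le (Y : Matrix (Fin n) (Fin n) ℝ) (R : Matrix (Fin m) (Fin m) ℝ)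
    (K : Matrix (Fin m) (Fin n) ℝ) : innerY Y K (R * K) ≤ ‖Y‖ * ‖R‖ * ‖K‖ ^ 2 := by
  calc innerY Y K (R * K) ≤ ‖K * Y‖ * ‖(R * K)ᵀ‖ := (le_abs_self _).trans (abs_trace_mul_le _ _)
    _ ≤ (‖K‖ * ‖Y‖) * (‖R‖ * ‖K‖) := by
      rw [Matrix.frobenius_norm_transpose]
      exact mul_le_mul (Matrix.frobenius_norm_mul _ _) (Matrix.frobenius_norm_mul _ _)
        (norm_nonneg _) (by positivity)
    _ = _ := by ring

/-! ### Spectral norm bounds -/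

theorem quad_le_spectralNorm (M : Matrix (Fin n) (Fin n) ℝ) (x : Fin n → ℝ) :
    x ⬝ᵥ (M *ᵥ x) ≤ spectralNorm₂ M * (x ⬝ᵥ x) := by
  set v : EuclideanSpace ℝ (Fin n) := WithLp.toLp 2 x
  have h1 : inner ℝ (Matrix.toEuclideanCLM (𝕜 := ℝ) M v) v = x ⬝ᵥ (M *ᵥ x) := by
    simp [v, EuclideanSpace.inner_eq_star_dotProduct]
  have h2 : ‖v‖ * ‖v‖ = x ⬝ᵥ x := by
    rw [← real_inner_self_eq_norm_mul_norm]
    rw [EuclideanSpace.inner_eq_star_dotProduct]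
    simp [v]
  rw [← h1, ← h2]
  calc inner ℝ (Matrix.toEuclideanCLM (𝕜 := ℝ) M v) v
      ≤ ‖Matrix.toEuclideanCLM (𝕜 := ℝ) M v‖ * ‖v‖ := real_inner_le_norm _ _
    _ ≤ (spectralNorm₂ M * ‖v‖) * ‖v‖ :=
      mul_le_mul_of_nonneg_right (ContinuousLinearMap.le_opNorm _ _) (norm_nonneg _)
    _ = _ := by ring

theorem spectralNorm₂_nonneg (M : Matrix (Fin n) (Fin n) ℝ) : 0 ≤ spectralNorm₂ M :=
  norm_nonneg _

theorem trace_mul_le_spectralNorm {M Z : Matrix (Fin n) (Fin n) ℝ} (hM : Mᵀ = M)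
    (hZ : Z.PosSemidef) : (M * Z).trace ≤ spectralNorm₂ M * Z.trace := by
  have h : (spectralNorm₂ M • 1 - M).PosSemidef := by
    refine posSemidef_real_iff.2 ⟨by simp [hM], fun x => ?_⟩
    simpa [Matrix.sub_mulVec, Matrix.smul_mulVec] using quad_le_spectralNorm M x
  have := trace_mul_nonneg_of_posSemidef h hZ
  simp only [Matrix.sub_mul, Matrix.trace_sub, Matrix.smul_mul, Matrix.one_mul,
    Matrix.trace_smul, smul_eq_mul] at this
  linarith

/-- The left side is `tr(Y D S D)` with `S = BR⁻¹Bᵀ`. Pulling out the spectral norms of `Y` and `S`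
leaves `tr D² ≤ (tr D)²`; this is the origin of the product of norms in `c(K)`. -/
theorem innerY_gainOf_le (hR : R.PosDef) {Y D : Matrix (Fin n) (Fin n) ℝ} (hY : Y.PosSemidef)
    (hD : D.PosSemidef) : innerY Y (gainOf B R D) (R * gainOf B R D) ≤
      spectralNorm₂ Y * spectralNorm₂ (B * R⁻¹ * Bᵀ) * D.trace ^ 2 := by
  have hS : (B * R⁻¹ * Bᵀ).PosSemidef := by
    simpa using hR.inv.posSemidef.transpose_mul_mul_same Bᵀ
  have h1 : (gainOf B R D)ᵀ * R * gainOf B R D = Dᵀ * (B * R⁻¹ * Bᵀ) * D := by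
    rw [Matrix.mul_assoc, hR.mul_gainOf, gainOf, Matrix.transpose_mul, Matrix.transpose_mul,
      Matrix.transpose_transpose, hR.inv.transpose_eq]
    simp only [Matrix.mul_assoc]
  have hDD : (D * D).PosSemidef := by
    have := Matrix.PosSemidef.one.transpose_mul_mul_same D
    rwa [hD.transpose_eq, Matrix.mul_one] at this
  have h2 : (Dᵀ * (B * R⁻¹ * Bᵀ) * D).trace = ((B * R⁻¹ * Bᵀ) * (D * D)).trace := by
    rw [hD.transpose_eq, Matrix.mul_assoc, Matrix.trace_mul_comm, Matrix.mul_assoc]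
  rw [innerY_mul_eq_trace hR, h1]
  calc _ ≤ spectralNorm₂ Y * (Dᵀ * (B * R⁻¹ * Bᵀ) * D).trace :=
        trace_mul_le_spectralNorm hY.transpose_eq (hS.transpose_mul_mul_same D)
    _ ≤ spectralNorm₂ Y * (spectralNorm₂ (B * R⁻¹ * Bᵀ) * D.trace ^ 2) := by
        refine mul_le_mul_of_nonneg_left ?_ (spectralNorm₂_nonneg _)
        rw [h2]
        exact (trace_mul_le_spectralNorm hS.transpose_eq hDD).trans
          (mul_le_mul_of_nonneg_left (trace_mul_self_le_sq_trace hD) (spectralNorm₂_nonneg _))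
    _ = _ := by ring

end LQR
/-! ### Sublevel sets of the cost, and the Riccati equation -/

section Riccati

variable {n m : ℕ} {A : Matrix (Fin n) (Fin n) ℝ} {B : Matrix (Fin n) (Fin m) ℝ}
  {Q : Matrix (Fin n) (Fin n) ℝ} {R : Matrix (Fin m) (Fin m) ℝ}

theorem lqrCost_nonneg (hQ : Q.PosDef) (hR : R.PosDef) {K : Matrix (Fin m) (Fin n) ℝ}
    (hK : K ∈ stabilizing A B) : 0 ≤ lqrCost A B Q R K :=
  (costMatrix_posDef hQ hR hK).posSemidef.trace_nonneg

theorem isOpen_stabilizing : IsOpen (stabilizing A B) :=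
  isOpen_isHurwitz.preimage (f := fun K : Matrix (Fin m) (Fin n) ℝ => A - B * K) (by fun_prop)

theorem continuousOn_lqrCost : ContinuousOn (lqrCost A B Q R) (stabilizing A B) := by
  have h : ContinuousOn (costMatrix A B Q R) (stabilizing A B) :=
    continuousOn_lyapunovSol.comp
      (f := fun K : Matrix (Fin m) (Fin n) ℝ => (A - B * K, Q + Kᵀ * R * K))
      (Continuous.continuousOn (by fun_prop)) fun _ hK => hK
  exact (Continuous.matrix_trace continuous_id).comp_continuousOn h

/-- The trace of the Lyapunov equation bounds `tr(KᵀRK)`, quadratic in `‖K‖`, by a term affine in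
`‖K‖`, because `‖P‖ ≤ tr P ≤ c`. -/
theorem exists_gain_norm_bound (hQ : Q.PosDef) (hR : R.PosDef) (c : ℝ) :
    ∃ k : ℝ, ∀ (K : Matrix (Fin m) (Fin n) ℝ) (P : Matrix (Fin n) (Fin n) ℝ), P.PosSemidef →
      (A - B * K)ᵀ * P + P * (A - B * K) = -(Q + Kᵀ * R * K) → P.trace ≤ c → ‖K‖ ≤ k := by
  obtain ⟨r, hr, hrK⟩ := exists_lower_bound_trace (n := n) hR
  refine ⟨1 + (2 * |c| * ‖A‖ + 2 * |c| * ‖B‖) / r, fun K P hP h hc => ?_⟩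
  have hPn : ‖P‖ ≤ |c| := (frobenius_norm_le_trace hP).trans (hc.trans (le_abs_self c))
  have h1 : ((A - B * K)ᵀ * P + P * (A - B * K)).trace = 2 * (P * (A - B * K)).trace := by
    rw [Matrix.trace_add, ← Matrix.trace_transpose ((A - B * K)ᵀ * P), Matrix.transpose_mul,
      Matrix.transpose_transpose, hP.transpose_eq]
    ring
  rw [h, Matrix.trace_neg, Matrix.trace_add] at h1
  have h2 : |(P * (A - B * K)).trace| ≤ |c| * (‖A‖ + ‖B‖ * ‖K‖) := by
    refine (abs_trace_mul_le _ _).trans (mul_le_mul hPn ?_ (norm_nonneg _) (abs_nonneg c))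
    exact (norm_sub_le _ _).trans (by gcongr; exact Matrix.frobenius_norm_mul B K)
  have h3 := hQ.posSemidef.trace_nonneg
  have h4 := (abs_le.1 h2).1
  have h5 : r * ‖K‖ ^ 2 ≤ 2 * |c| * ‖A‖ + 2 * |c| * ‖B‖ * ‖K‖ := by
    linarith [hrK K]
  rcases le_or_gt ‖K‖ 1 with h6 | h6
  · have : 0 ≤ (2 * |c| * ‖A‖ + 2 * |c| * ‖B‖) / r := by positivity
    linarith
  · have h7 : ‖K‖ ≤ (2 * |c| * ‖A‖ + 2 * |c| * ‖B‖) / r := by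
      rw [le_div_iff₀ hr]
      have h8 : 0 ≤ 2 * |c| * ‖A‖ := by positivity
      have h9 : 0 < ‖K‖ := by linarith
      refine le_of_mul_le_mul_right ?_ h9
      nlinarith
    linarith

/-- The sublevel set is the projection of a closed bounded set of pairs `(K, P)` that does not
mention stability: the Lyapunov equation with `P ≥ 0` already forces `A - BK` to be Hurwitz. -/
theorem isCompact_lqrCost_sublevel (hQ : Q.PosDef) (hR : R.PosDef) (c : ℝ) :
    IsCompact {K | K ∈ stabilizing A B ∧ lqrCost A B Q R K ≤ c} := by
  let C : Set (Matrix (Fin m) (Fin n) ℝ × Matrix (Fin n) (Fin n) ℝ) :=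
    {p | p.2.PosSemidef ∧ ((A - B * p.1)ᵀ * p.2 + p.2 * (A - B * p.1) =
      -(Q + p.1ᵀ * R * p.1) ∧ p.2.trace ≤ c)}
  have himg : {K | K ∈ stabilizing A B ∧ lqrCost A B Q R K ≤ c} = Prod.fst '' C := by
    ext K
    constructor
    · rintro ⟨hK, hc⟩
      exact ⟨(K, costMatrix A B Q R K), ⟨(costMatrix_posDef hQ hR hK).posSemidef,
        costMatrix_spec hK, hc⟩, rfl⟩
    · rintro ⟨⟨K', P⟩, ⟨hP, h, hc⟩, rfl⟩
      simp only at hP h hc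
      have hM := stageCost_posDef hQ hR K'
      have hK : IsHurwitz (A - B * K') :=
        isHurwitz_of_lyapunov (posDef_of_posSemidef_lyapunov hP hM h) (by rwa [h, neg_neg])
      refine ⟨hK, ?_⟩
      rw [lqrCost, costMatrix, ← hK.eq_lyapunovSol h]
      exact hc
  have hclosed : IsClosed C := by
    have h1 : Continuous fun p : Matrix (Fin m) (Fin n) ℝ × Matrix (Fin n) (Fin n) ℝ =>
        (A - B * p.1)ᵀ * p.2 + p.2 * (A - B * p.1) := by fun_prop
    have h2 : Continuous fun p : Matrix (Fin m) (Fin n) ℝ × Matrix (Fin n) (Fin n) ℝ =>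
        -(Q + p.1ᵀ * R * p.1) := by fun_prop
    have h3 : Continuous fun p : Matrix (Fin m) (Fin n) ℝ × Matrix (Fin n) (Fin n) ℝ =>
        p.2.trace := by fun_prop
    exact (isClosed_posSemidef.preimage continuous_snd).inter
      ((isClosed_eq h1 h2).inter (isClosed_le h3 continuous_const))
  have hcompact : IsCompact C := by
    obtain ⟨k, hk⟩ := exists_gain_norm_bound (A := A) (B := B) hQ hR c
    have : ProperSpace (Matrix (Fin m) (Fin n) ℝ) := FiniteDimensional.proper_real _
    have : ProperSpace (Matrix (Fin n) (Fin n) ℝ) := FiniteDimensional.proper_real _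
    have h1 : IsCompact (Metric.closedBall (0 : Matrix (Fin m) (Fin n) ℝ) k) :=
      isCompact_closedBall _ _
    have h2 : IsCompact (Metric.closedBall (0 : Matrix (Fin n) (Fin n) ℝ) c) :=
      isCompact_closedBall _ _
    refine (h1.prod h2).of_isClosed_subset hclosed ?_
    rintro ⟨K, P⟩ ⟨hP, h, hc⟩
    exact ⟨mem_closedBall_zero_iff.2 (hk K P hP h hc),
      mem_closedBall_zero_iff.2 ((frobenius_norm_le_trace hP).trans hc)⟩
  rw [himg]
  exact hcompact.image continuous_fst

theorem exists_lqrCost_minimizer (hQ : Q.PosDef) (hR : R.PosDef) (hAB : IsStabilizable A B) :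
    ∃ K ∈ stabilizing A B, ∀ K' ∈ stabilizing A B, lqrCost A B Q R K ≤ lqrCost A B Q R K' := by
  obtain ⟨K₀, hK₀⟩ := hAB
  obtain ⟨K, ⟨hK, hc⟩, hmin⟩ :=
    (isCompact_lqrCost_sublevel (A := A) (B := B) hQ hR (lqrCost A B Q R K₀)).exists_isMinOn
      ⟨K₀, hK₀, le_rfl⟩ (continuousOn_lqrCost.mono fun K hK => hK.1)
  refine ⟨K, hK, fun K' hK' => ?_⟩
  rcases le_total (lqrCost A B Q R K') (lqrCost A B Q R K₀) with h | h
  · exact hmin ⟨hK', h⟩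
  · exact hc.trans h

/-- One step of policy improvement. -/
theorem gainOf_costMatrix_mem (hQ : Q.PosDef) (hR : R.PosDef) {K : Matrix (Fin m) (Fin n) ℝ}
    (hK : K ∈ stabilizing A B) : gainOf B R (costMatrix A B Q R K) ∈ stabilizing A B := by
  have hP := costMatrix_posDef hQ hR hK
  refine isHurwitz_of_lyapunov hP ?_
  rw [lyapunov_change_gain hR hP.transpose_eq (costMatrix_spec hK), sub_self, zero_sub, neg_add,
    neg_neg, neg_neg]
  exact (stageCost_posDef hQ hR _).add_posSemidef (hR.posSemidef.transpose_mul_mul_same _)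

/-- At a minimizer of the cost, policy improvement lowers the cost by a weighted square norm of `K -
K'`. Minimality makes this zero, so `K` is the gain of its own cost matrix. -/
theorem exists_riccati_solution (hQ : Q.PosDef) (hR : R.PosDef) (hAB : IsStabilizable A B) :
    ∃ P : Matrix (Fin n) (Fin n) ℝ, P.PosDef ∧ riccati A B Q R P = 0 := by
  obtain ⟨K, hK, hmin⟩ := exists_lqrCost_minimizer hQ hR hAB
  have hP := costMatrix_posDef hQ hR hK
  set P := costMatrix A B Q R K with hPdef
  set K' := gainOf B R P with hK'def
  have hK' : K' ∈ stabilizing A B := gainOf_costMatrix_mem hQ hR hK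
  have h1 := lyapunov_costMatrix_sub hQ hR hK hK'
  rw [← hPdef, ← hK'def, sub_self, zero_sub] at h1
  have h2 := trace_eq_trace_gramian_mul (gramian_spec hK') h1
  rw [← innerY_mul_eq_trace hR, Matrix.trace_sub] at h2
  obtain ⟨r, hr, hlow⟩ := exists_lower_bound_innerY hR (gramian_posDef hK')
  have h3 := hlow (K - K')
  have h4 : P.trace ≤ (costMatrix A B Q R K').trace := hmin K' hK'
  have h5 : ‖K - K'‖ = 0 := by
    by_contra hne
    have : 0 < ‖K - K'‖ := lt_of_le_of_ne (norm_nonneg _) (Ne.symm hne)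
    have : 0 < r * ‖K - K'‖ ^ 2 := by positivity
    linarith
  have h6 : K = K' := sub_eq_zero.1 (norm_eq_zero.1 h5)
  refine ⟨P, hP, ?_⟩
  rw [riccati_eq_lyapunov hR hP.transpose_eq, ← hK'def, ← h6, costMatrix_spec hK, neg_add_cancel]

theorem areSol_spec (hQ : Q.PosDef) (hR : R.PosDef) (hAB : IsStabilizable A B) :
    (areSol A B Q R).PosDef ∧ riccati A B Q R (areSol A B Q R) = 0 := by
  have h := exists_riccati_solution hQ hR hAB
  rw [areSol, dif_pos h]
  exact h.choose_spec

theorem optGain_spec (hQ : Q.PosDef) (hR : R.PosDef) (hAB : IsStabilizable A B) :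
    (A - B * optGain A B Q R)ᵀ * areSol A B Q R + areSol A B Q R * (A - B * optGain A B Q R) =
      -(Q + (optGain A B Q R)ᵀ * R * optGain A B Q R) := by
  obtain ⟨hP, h⟩ := areSol_spec hQ hR hAB
  rw [riccati_eq_lyapunov hR hP.transpose_eq] at h
  exact eq_neg_of_add_eq_zero_left h

theorem optGain_mem (hQ : Q.PosDef) (hR : R.PosDef) (hAB : IsStabilizable A B) :
    optGain A B Q R ∈ stabilizing A B := by
  refine isHurwitz_of_lyapunov (areSol_spec hQ hR hAB).1 ?_
  rw [optGain_spec hQ hR hAB, neg_neg]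
  exact stageCost_posDef hQ hR _

theorem costMatrix_optGain (hQ : Q.PosDef) (hR : R.PosDef) (hAB : IsStabilizable A B) :
    costMatrix A B Q R (optGain A B Q R) = areSol A B Q R :=
  (IsHurwitz.eq_lyapunovSol (optGain_mem hQ hR hAB) (optGain_spec hQ hR hAB)).symm

theorem gainOf_costMatrix_optGain (hQ : Q.PosDef) (hR : R.PosDef) (hAB : IsStabilizable A B) :
    gainOf B R (costMatrix A B Q R (optGain A B Q R)) = optGain A B Q R := by
  rw [costMatrix_optGain hQ hR hAB, optGain]

/-- `K*` is the gain of its own cost matrix, so the terms linear in the gain difference vanish and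
`P_K - P*` solves a Lyapunov equation with semidefinite data. -/
theorem costMatrix_sub_optGain_posSemidef (hQ : Q.PosDef) (hR : R.PosDef)
    (hAB : IsStabilizable A B) {K : Matrix (Fin m) (Fin n) ℝ} (hK : K ∈ stabilizing A B) :
    (costMatrix A B Q R K - costMatrix A B Q R (optGain A B Q R)).PosSemidef := by
  have h := lyapunov_costMatrix_sub hQ hR (optGain_mem hQ hR hAB) hK
  rw [gainOf_costMatrix_optGain hQ hR hAB, sub_self, Matrix.mul_zero, Matrix.transpose_zero,
    Matrix.zero_mul, Matrix.zero_mul, sub_zero, sub_zero] at h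
  refine posSemidef_of_lyapunov hK
    (hR.posSemidef.transpose_mul_mul_same (optGain A B Q R - K)) ?_
  rw [← h]
  simp only [Matrix.mul_sub, Matrix.sub_mul]
  abel

theorem lqrCost_optGain_le (hQ : Q.PosDef) (hR : R.PosDef)
    (hAB : IsStabilizable A B) {K : Matrix (Fin m) (Fin n) ℝ} (hK : K ∈ stabilizing A B) :
    lqrCost A B Q R (optGain A B Q R) ≤ lqrCost A B Q R K := by
  have := (costMatrix_sub_optGain_posSemidef hQ hR hAB hK).trace_nonneg
  rw [Matrix.trace_sub] at this
  exact sub_nonneg.1 this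

/-! ### The Lyapunov function is a size function -/

/-- Each compact sublevel set is bounded and has positive distance to the frontier, which is
disjoint from the open set of stabilizing gains. The sequence eventually leaves it. -/
theorem tendsto_lqrCost_atTop (hQ : Q.PosDef) (hR : R.PosDef)
    {x : ℕ → Matrix (Fin m) (Fin n) ℝ} (hx : ∀ k, x k ∈ stabilizing A B)
    (h : Tendsto (fun k => Metric.infEDist (x k) (frontier (stabilizing A B))) atTop (𝓝 0) ∨
      Tendsto (fun k => ‖x k‖) atTop atTop) :
    Tendsto (fun k => lqrCost A B Q R (x k)) atTop atTop := by
  rw [tendsto_atTop]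
  intro c
  have hC := isCompact_lqrCost_sublevel (A := A) (B := B) hQ hR c
  set C := {K | K ∈ stabilizing A B ∧ lqrCost A B Q R K ≤ c}
  suffices hev : ∀ᶠ k in atTop, x k ∉ C by
    filter_upwards [hev] with k hk
    by_contra hlt
    exact hk ⟨hx k, (not_le.1 hlt).le⟩
  rcases h with h | h
  · have hdisj : Disjoint C (frontier (stabilizing A B)) := by
      rw [Set.disjoint_left]
      rintro K ⟨hK, -⟩ hf
      rw [isOpen_stabilizing.frontier_eq] at hf
      exact hf.2 hK
    obtain ⟨r, hr, hsep⟩ := Metric.exists_pos_forall_lt_edist hC isClosed_frontier hdisj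
    have hpos : (0 : ℝ≥0∞) < r := by exact_mod_cast hr
    filter_upwards [h.eventually (gt_mem_nhds hpos)] with k hk hkC
    obtain ⟨y, hy, hlt⟩ := Metric.infEDist_lt_iff.1 hk
    exact absurd hlt (not_lt.2 (hsep _ hkC y hy).le)
  · obtain ⟨b, hb⟩ := hC.isBounded.exists_norm_le
    filter_upwards [h.eventually_gt_atTop b] with k hk hkC
    exact absurd hk (not_lt.2 (hb _ hkC))

theorem lqrCost_sub_le_gaussNewtonLyapunov (hQ : Q.PosDef) (hR : R.PosDef)
    (hAB : IsStabilizable A B) (K : Matrix (Fin m) (Fin n) ℝ) :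
    lqrCost A B Q R K - lqrCost A B Q R (optGain A B Q R) ≤ gaussNewtonLyapunov A B Q R K := by
  have := innerY_mul_self_nonneg hR (gramian_posDef (optGain_mem hQ hR hAB)).posSemidef
    (K - optGain A B Q R)
  rw [gaussNewtonLyapunov]
  linarith

theorem gaussNewtonLyapunov_nonneg (hQ : Q.PosDef) (hR : R.PosDef)
    (hAB : IsStabilizable A B) {K : Matrix (Fin m) (Fin n) ℝ} (hK : K ∈ stabilizing A B) :
    0 ≤ gaussNewtonLyapunov A B Q R K :=
  (sub_nonneg.2 (lqrCost_optGain_le hQ hR hAB hK)).trans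
    (lqrCost_sub_le_gaussNewtonLyapunov hQ hR hAB K)

theorem isSizeFunction_gaussNewtonLyapunov (hQ : Q.PosDef) (hR : R.PosDef)
    (hAB : IsStabilizable A B) :
    IsSizeFunction (stabilizing A B) (optGain A B Q R) (gaussNewtonLyapunov A B Q R) where
  continuousOn := by
    refine (continuousOn_lqrCost.sub continuousOn_const).add (Continuous.continuousOn ?_)
    unfold innerY
    have : Continuous fun K : Matrix (Fin m) (Fin n) ℝ => 1 / 2 * ((K - optGain A B Q R) *
      gramian A B (optGain A B Q R) * (R * (K - optGain A B Q R))ᵀ).trace := by fun_prop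
    exact this
  zero_at := by simp [gaussNewtonLyapunov, innerY]
  pos K hK hne := by
    obtain ⟨r, hr, hlow⟩ := exists_lower_bound_innerY hR (gramian_posDef (optGain_mem hQ hR hAB))
    have h1 := hlow (K - optGain A B Q R)
    have h2 : 0 < ‖K - optGain A B Q R‖ := norm_pos_iff.2 (sub_ne_zero.2 hne)
    have h3 : 0 < r * ‖K - optGain A B Q R‖ ^ 2 := by positivity
    have h4 := lqrCost_optGain_le hQ hR hAB hK
    rw [gaussNewtonLyapunov]
    linarith
  coercive x hx h := by
    refine tendsto_atTop_mono (fun k => lqrCost_sub_le_gaussNewtonLyapunov hQ hR hAB (x k)) ?_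
    exact tendsto_atTop_add_const_right _ _ (tendsto_lqrCost_atTop hQ hR hx h)

end Riccati
/-! ### The one-step estimate -/

section Step

variable {n m : ℕ} {A : Matrix (Fin n) (Fin n) ℝ} {B : Matrix (Fin n) (Fin m) ℝ}
  {Q : Matrix (Fin n) (Fin n) ℝ} {R : Matrix (Fin m) (Fin m) ℝ}

/-- The weight is the Gramian of the comparison gain `K'`. For `K' = K*` it is therefore fixed along
the iteration, and the inner product is exactly the linear term in the expansion of `e`. -/
theorem lqrCost_sub_eq (hQ : Q.PosDef) (hR : R.PosDef) {K K' : Matrix (Fin m) (Fin n) ℝ}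
    (hK : K ∈ stabilizing A B) (hK' : K' ∈ stabilizing A B) :
    lqrCost A B Q R K - lqrCost A B Q R K' =
      2 * innerY (gramian A B K') (K - K') (R * (K - gainOf B R (costMatrix A B Q R K))) -
        innerY (gramian A B K') (K - K') (R * (K - K')) := by
  have h1 := lyapunov_costMatrix_sub hQ hR hK hK'
  set M := K - gainOf B R (costMatrix A B Q R K)
  have h2 := trace_eq_trace_gramian_mul (gramian_spec hK') (h1.trans (neg_neg _).symm)
  rw [Matrix.trace_sub, neg_sub, sub_sub_eq_add_sub, Matrix.mul_sub, Matrix.mul_add,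
    Matrix.trace_sub, Matrix.trace_add, ← innerY_mul_eq_trace hR, ← innerY_mul_eq_trace hR,
    ← innerY_mul_eq_trace hR,
    innerY_mul_comm hR (gramian_posDef hK').transpose_eq M (K - K')] at h2
  rw [lqrCost, lqrCost, h2]
  ring

theorem exists_disturbance_bound (hQ : Q.PosDef) (R : Matrix (Fin m) (Fin m) ℝ) (hR : Rᵀ = R) :
    ∃ κ : ℝ, 0 < κ ∧ ∀ W : Matrix (Fin m) (Fin n) ℝ,
      ((κ * ‖W‖ ^ 2) • Q - Wᵀ * R * W).PosSemidef := by
  obtain ⟨q, hq, hqQ⟩ := hQ.exists_coercive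
  refine ⟨(‖R‖ + 1) / q, by positivity, fun W => posSemidef_real_iff.2 ⟨?_, fun x => ?_⟩⟩
  · simp [Matrix.transpose_mul, hR, hQ.transpose_eq, Matrix.mul_assoc]
  · have h1 : x ⬝ᵥ ((Wᵀ * R * W) *ᵥ x) ≤ ‖R‖ * (‖W‖ ^ 2 * (x ⬝ᵥ x)) := by
      rw [← Matrix.mulVec_mulVec, ← Matrix.mulVec_mulVec, Matrix.mulVec_transpose,
        dotProduct_comm, ← Matrix.dotProduct_mulVec, dotProduct_comm]
      exact (le_abs_self _).trans ((abs_quad_le R (W *ᵥ x)).trans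
        (mul_le_mul_of_nonneg_left (dotProduct_mulVec_self_le W x) (norm_nonneg _)))
    have h2 : (‖R‖ + 1) / q * ‖W‖ ^ 2 * (q * (x ⬝ᵥ x)) ≤
        (‖R‖ + 1) / q * ‖W‖ ^ 2 * (x ⬝ᵥ (Q *ᵥ x)) :=
      mul_le_mul_of_nonneg_left (hqQ x) (by positivity)
    have h3 : (‖R‖ + 1) / q * ‖W‖ ^ 2 * (q * (x ⬝ᵥ x)) =
        ‖R‖ * (‖W‖ ^ 2 * (x ⬝ᵥ x)) + ‖W‖ ^ 2 * (x ⬝ᵥ x) := by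
      field_simp
    have h4 : 0 ≤ ‖W‖ ^ 2 * (x ⬝ᵥ x) := mul_nonneg (sq_nonneg _) (dotProduct_self_nonneg_real x)
    rw [Matrix.sub_mulVec, dotProduct_sub, Matrix.smul_mulVec, dotProduct_smul, smul_eq_mul]
    linarith

theorem stepConst_ge_one (hQ : Q.PosDef) (hR : R.PosDef) {K : Matrix (Fin m) (Fin n) ℝ}
    (hK : K ∈ stabilizing A B) : 1 ≤ stepConst A B Q R K := by
  have := (costMatrix_posDef hQ hR hK).posSemidef.trace_nonneg
  have : 0 ≤ spectralNorm₂ (gramian A B (optGain A B Q R)) * spectralNorm₂ (B * R⁻¹ * Bᵀ) *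
      (costMatrix A B Q R K).trace :=
    mul_nonneg (mul_nonneg (spectralNorm₂_nonneg _) (spectralNorm₂_nonneg _)) this
  rw [stepConst]
  linarith

/-- The perturbed gain is stabilizing, and its cost is controlled by the previous one. -/
theorem gaussNewtonUpdate_mem_and_lqrCost_le (hQ : Q.PosDef) (hR : R.PosDef)
    {K W : Matrix (Fin m) (Fin n) ℝ} (hK : K ∈ stabilizing A B) {κ η : ℝ} (hκ : 0 < κ)
    (hW : ((κ * ‖W‖ ^ 2) • Q - Wᵀ * R * W).PosSemidef) (hsmall : 2 * κ * ‖W‖ ^ 2 ≤ 1)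
    (hη0 : 0 ≤ η) (hη1 : η ≤ 1) :
    gaussNewtonUpdate A B Q R η K W ∈ stabilizing A B ∧
      (1 - η * (κ * ‖W‖ ^ 2)) * lqrCost A B Q R (gaussNewtonUpdate A B Q R η K W) ≤
        lqrCost A B Q R K := by
  have hP := costMatrix_posDef hQ hR hK
  set P := costMatrix A B Q R K with hPdef
  set M := K - gainOf B R P with hM
  set K' := gaussNewtonUpdate A B Q R η K W with hK'def
  have hΔ : K - K' = η • (M + W) := by
    rw [hK'def, gaussNewtonUpdate, ← hPdef, ← hM, sub_sub_cancel]
  have h1 := lyapunov_change_gain hR hP.transpose_eq (costMatrix_spec hK) K'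
  rw [← hM, hΔ] at h1
  set s := κ * ‖W‖ ^ 2 with hs
  have hs0 : 0 ≤ s := by positivity
  have hs1 : η * s ≤ 1 / 2 := by
    have := mul_le_mul_of_nonneg_right hη1 hs0
    linarith
  -- With `Z = M + W`, polarization `ZᵀRM + MᵀRZ = ZᵀRZ + MᵀRM - WᵀRW` isolates the only harmful
  -- term `WᵀRW`; giving up the fraction `ηs` of the stage cost pays for it.
  set N : Matrix (Fin n) (Fin n) ℝ := (η * s) • (K'ᵀ * R * K') + η • (s • Q - Wᵀ * R * W) +
    η • (Mᵀ * R * M) + (η * (1 - η)) • ((M + W)ᵀ * R * (M + W)) with hN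
  have hNpsd : N.PosSemidef := by
    have hq := fun L : Matrix (Fin m) (Fin n) ℝ => hR.posSemidef.transpose_mul_mul_same L
    exact ((((hq K').smul (mul_nonneg hη0 hs0)).add (hW.smul hη0)).add ((hq M).smul hη0)).add
      ((hq (M + W)).smul (mul_nonneg hη0 (sub_nonneg.2 hη1)))
  have h2 : (A - B * K')ᵀ * P + P * (A - B * K') =
      -((1 - η * s) • (Q + K'ᵀ * R * K') + N) := by
    rw [h1, hN]
    simp only [Matrix.transpose_smul, Matrix.transpose_add, Matrix.add_mul, Matrix.mul_add,
      Matrix.smul_mul, Matrix.mul_smul, smul_add, smul_sub, smul_smul]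
    module
  have hpos : 0 < 1 - η * s := by linarith
  have hstage := stageCost_posDef hQ hR K'
  have hK' : K' ∈ stabilizing A B := by
    refine isHurwitz_of_lyapunov hP ?_
    rw [h2, neg_neg]
    exact (hstage.smul hpos).add_posSemidef hNpsd
  refine ⟨hK', ?_⟩
  have h3 : (P - (1 - η * s) • costMatrix A B Q R K').PosSemidef := by
    refine posSemidef_of_lyapunov hK' hNpsd ?_
    rw [Matrix.mul_sub, Matrix.sub_mul, Matrix.mul_smul, Matrix.smul_mul, sub_add_sub_comm, h2,
      ← smul_add, costMatrix_spec hK', smul_neg]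
    abel
  have h4 := h3.trace_nonneg
  rw [Matrix.trace_sub, Matrix.trace_smul, smul_eq_mul] at h4
  exact sub_nonneg.1 h4

/-- `M` is `E` minus the gain of `D = P_K - P*`. The parallelogram inequality bounds its square norm
by twice the sum of the two square norms, and the one of the gain of `D` is at most `(c - 1) tr D`
since `tr D ≤ tr P_K`. -/
theorem innerY_gainError_le (hQ : Q.PosDef) (hR : R.PosDef) (hAB : IsStabilizable A B)
    {K : Matrix (Fin m) (Fin n) ℝ} (hK : K ∈ stabilizing A B) :
    innerY (gramian A B (optGain A B Q R)) (K - gainOf B R (costMatrix A B Q R K))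
        (R * (K - gainOf B R (costMatrix A B Q R K))) ≤
      2 * stepConst A B Q R K * (lqrCost A B Q R K - lqrCost A B Q R (optGain A B Q R) +
        innerY (gramian A B (optGain A B Q R)) (K - optGain A B Q R)
          (R * (K - optGain A B Q R))) := by
  have hKs := optGain_mem hQ hR hAB
  have hY := gramian_posDef hKs
  set Ks := optGain A B Q R with hKsdef
  set Y := gramian A B Ks with hYdef
  set D := costMatrix A B Q R K - costMatrix A B Q R Ks with hD
  have hDpsd : D.PosSemidef := costMatrix_sub_optGain_posSemidef hQ hR hAB hK
  have hM : K - gainOf B R (costMatrix A B Q R K) = (K - Ks) + (-1 : ℝ) • gainOf B R D := by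
    have h1 : gainOf B R D = gainOf B R (costMatrix A B Q R K) - Ks := by
      rw [hD, gainOf, Matrix.mul_sub]
      exact congr_arg _ (gainOf_costMatrix_optGain hQ hR hAB)
    rw [h1]
    module
  have h1 := innerY_mul_add_smul hR hY.transpose_eq (K - Ks) (gainOf B R D) (-1)
  have h2 := innerY_mul_add_smul hR hY.transpose_eq (K - Ks) (gainOf B R D) 1
  have h3 := innerY_mul_self_nonneg hR hY.posSemidef (K - Ks + (1 : ℝ) • gainOf B R D)
  have h4 := innerY_gainOf_le (B := B) hR hY.posSemidef hDpsd
  have h5 : D.trace = lqrCost A B Q R K - lqrCost A B Q R Ks := Matrix.trace_sub _ _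
  have h6 : 0 ≤ D.trace := hDpsd.trace_nonneg
  have h7 : D.trace ≤ (costMatrix A B Q R K).trace := by
    have := lqrCost_nonneg hQ hR hKs
    have h8 : (costMatrix A B Q R K).trace = lqrCost A B Q R K := rfl
    linarith
  have he := innerY_mul_self_nonneg hR hY.posSemidef (K - Ks)
  have hc := stepConst_ge_one hQ hR hK
  set e := innerY Y (K - Ks) (R * (K - Ks))
  set τ := spectralNorm₂ Y * spectralNorm₂ (B * R⁻¹ * Bᵀ) with hτ
  have hτ0 : 0 ≤ τ := mul_nonneg (spectralNorm₂_nonneg _) (spectralNorm₂_nonneg _)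
  have hc' : stepConst A B Q R K = 1 + τ * (costMatrix A B Q R K).trace := rfl
  have h9 : τ * D.trace ^ 2 ≤ (stepConst A B Q R K - 1) * D.trace := by
    rw [hc', add_sub_cancel_left, sq, ← mul_assoc]
    exact mul_le_mul_of_nonneg_right (mul_le_mul_of_nonneg_left h7 hτ0) h6
  rw [hM, ← h5]
  have h10 : e ≤ stepConst A B Q R K * e := le_mul_of_one_le_left he hc
  rw [h2] at h3
  rw [h1]
  linarith

theorem gaussNewtonLyapunov_step (hQ : Q.PosDef) (hR : R.PosDef) (hAB : IsStabilizable A B) :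
    ∃ a b : ℝ, 0 < a ∧ 0 < b ∧ ∀ K ∈ stabilizing A B, ∀ (W : Matrix (Fin m) (Fin n) ℝ) (η : ℝ),
      a * ‖W‖ ^ 2 ≤ 1 → 0 ≤ η → η ≤ maxStep A B Q R K →
      gaussNewtonUpdate A B Q R η K W ∈ stabilizing A B ∧
      gaussNewtonLyapunov A B Q R (gaussNewtonUpdate A B Q R η K W) -
        gaussNewtonLyapunov A B Q R K ≤
      -(η / 16) * gaussNewtonLyapunov A B Q R K +
        η * (‖W‖ ^ 2 * (a * gaussNewtonLyapunov A B Q R K + b)) := by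
  obtain ⟨κ, hκ, hκW⟩ := exists_disturbance_bound hQ R hR.transpose_eq
  have hKs := optGain_mem hQ hR hAB
  have hY := gramian_posDef hKs
  have hJs := lqrCost_nonneg hQ hR hKs
  have hVJ := lqrCost_sub_le_gaussNewtonLyapunov hQ hR hAB
  have hVdef : ∀ K, gaussNewtonLyapunov A B Q R K =
    lqrCost A B Q R K - lqrCost A B Q R (optGain A B Q R) +
    1 / 2 * innerY (gramian A B (optGain A B Q R)) (K - optGain A B Q R)
      (R * (K - optGain A B Q R)) := fun _ => rfl
  set Ks := optGain A B Q R with hKsdef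
  set Y := gramian A B Ks with hYdef
  set C := ‖Y‖ * ‖R‖ with hC
  have hC0 : 0 ≤ C := by positivity
  -- The coefficient `2κ` makes `ηκ‖W‖² ≤ 1/2` and also bounds the cost growth. In `b`, `6C` covers
  -- the quadratic terms in `W`, and `1` ensures positivity.
  refine ⟨2 * κ, 2 * κ * lqrCost A B Q R Ks + 6 * C + 1, by positivity, by linarith [mul_nonneg hκ.le hJs],
    fun K hK W η hsmall hη0 hηmax => ?_⟩
  have hη1 : η ≤ 1 := hηmax.trans (min_le_left _ _)
  have hc := stepConst_ge_one hQ hR hK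
  have hηc : η * stepConst A B Q R K ≤ 1 / 4 := by
    have h1 : η ≤ 1 / (4 * stepConst A B Q R K) := hηmax.trans (min_le_right _ _)
    rw [le_div_iff₀ (by positivity)] at h1
    linarith
  obtain ⟨hK', hcost⟩ :=
    gaussNewtonUpdate_mem_and_lqrCost_le hQ hR hK hκ (hκW W) hsmall hη0 hη1
  refine ⟨hK', ?_⟩
  have hM := innerY_gainError_le hQ hR hAB hK
  have hh := lqrCost_optGain_le hQ hR hAB hK
  have hgap := lqrCost_sub_eq hQ hR hK hKs
  have hJ := lqrCost_nonneg hQ hR hK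
  have hJ' := lqrCost_nonneg hQ hR hK'
  have hVK := hVJ K
  have hVK' := hVdef (gaussNewtonUpdate A B Q R η K W)
  have hVKd := hVdef K
  set M := K - gainOf B R (costMatrix A B Q R K) with hMdef
  set K' := gaussNewtonUpdate A B Q R η K W with hK'def
  have hE' : K' - Ks = (K - Ks) + (-η) • (M + W) := by
    rw [hK'def, gaussNewtonUpdate, ← hMdef]
    module
  have hYt := hY.transpose_eq
  have hsq := innerY_mul_add_smul hR hYt (K - Ks) (M + W) (-η)
  rw [innerY_add_right Y (K - Ks) M W, ← hE'] at hsq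
  have hMW := innerY_mul_add_smul hR hYt M W 1
  rw [one_smul] at hMW
  -- Young inequalities, as nonnegativity of the squares of `M - 2W` and `E + 8W`. The weight `8`
  -- leaves only `e/16` to be absorbed by the decay.
  have hMW2 := innerY_mul_add_smul hR hYt M W (-2)
  have hMW0 := innerY_mul_self_nonneg hR hY.posSemidef (M + (-2 : ℝ) • W)
  have hEW := innerY_mul_add_smul hR hYt (K - Ks) W 8
  have hEW0 := innerY_mul_self_nonneg hR hY.posSemidef (K - Ks + (8 : ℝ) • W)
  have hWb := innerY_mul_self_le Y R W
  have hW0 := innerY_mul_self_nonneg hR hY.posSemidef W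
  have he0 := innerY_mul_self_nonneg hR hY.posSemidef (K - Ks)
  set v := gaussNewtonLyapunov A B Q R K
  set v' := gaussNewtonLyapunov A B Q R K'
  set J := lqrCost A B Q R K
  set J' := lqrCost A B Q R K'
  set Js := lqrCost A B Q R Ks
  set e := innerY Y (K - Ks) (R * (K - Ks))
  set e' := innerY Y (K' - Ks) (R * (K' - Ks))
  set eM := innerY Y M (R * M)
  set eZ := innerY Y (M + W) (R * (M + W))
  set eW := innerY Y W (R * W)
  set gM := innerY Y (K - Ks) (R * M)
  set gW := innerY Y (K - Ks) (R * W)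
  set c := stepConst A B Q R K
  set ω := ‖W‖ ^ 2
  have hω0 : 0 ≤ ω := sq_nonneg _
  rw [hMW2] at hMW0
  rw [hEW] at hEW0
  have hZ : eZ ≤ 3 / 2 * eM + 3 * eW := by linarith
  have hgW : -gW ≤ e / 16 + 4 * eW := by linarith
  have hq0 : 0 ≤ J - Js + e := by linarith
  have hηZ : η ^ 2 * eZ ≤ η * (3 / 4 * (J - Js + e)) + η * (3 * eW) := by
    have h1 : η * eM ≤ 1 / 2 * (J - Js + e) := by
      calc η * eM ≤ η * (2 * c * (J - Js + e)) := mul_le_mul_of_nonneg_left hM hη0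
        _ = 2 * (η * c) * (J - Js + e) := by ring
        _ ≤ 2 * (1 / 4) * (J - Js + e) := by gcongr
        _ = _ := by ring
    have h2 : η * eW ≤ eW := mul_le_of_le_one_left hW0 hη1
    have h3 : η * eZ ≤ 3 / 4 * (J - Js + e) + 3 * eW := by
      have := mul_le_mul_of_nonneg_left hZ hη0
      linarith
    have := mul_le_mul_of_nonneg_left h3 hη0
    calc η ^ 2 * eZ = η * (η * eZ) := by ring
      _ ≤ _ := this
      _ = _ := by ring
  have hcross := mul_le_mul_of_nonneg_left hgW hη0
  -- The gap identity: the linear term yields the full decay `-η(h + e)`, of which `hηZ` consumes at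
  -- most three quarters.
  have hgM : η * (2 * gM) = η * (J - Js + e) := by rw [hgap]; ring
  have hWC : η * eW ≤ C * (η * ω) :=
    (mul_le_mul_of_nonneg_left hWb hη0).trans_eq (by rw [hC]; ring)
  have hθ0 : 0 ≤ η * (κ * ω) := by positivity
  have hθ1 : η * (κ * ω) ≤ 1 / 2 := by
    have := mul_le_mul_of_nonneg_right hη1 (by positivity : 0 ≤ κ * ω)
    linarith
  have hcost' : J' ≤ J + 2 * (η * (κ * ω)) * J := by
    -- For `0 ≤ θ ≤ 1/2` one has `1/(1 - θ) ≤ 1 + 2θ`.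
    set θ := η * (κ * ω)
    have h1 : 1 ≤ (1 + 2 * θ) * (1 - θ) := by
      linarith [mul_nonneg hθ0 (sub_nonneg.2 hθ1)]
    calc J' ≤ ((1 + 2 * θ) * (1 - θ)) * J' := le_mul_of_one_le_left hJ' h1
      _ = (1 + 2 * θ) * ((1 - θ) * J') := by ring
      _ ≤ (1 + 2 * θ) * J := mul_le_mul_of_nonneg_left hcost (by positivity)
      _ = _ := by ring
  have hJv : 2 * (η * (κ * ω)) * J ≤ 2 * (η * (κ * ω)) * (v + Js) :=
    mul_le_mul_of_nonneg_left (by linarith) (by positivity)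
  have hηω : 0 ≤ η * ω := by positivity
  have hhη : 0 ≤ η * (J - Js) := mul_nonneg hη0 (by linarith)
  have heη : 0 ≤ η * e := mul_nonneg hη0 he0
  have hWη : 0 ≤ η * eW := mul_nonneg hη0 hW0
  have hCω : 0 ≤ C * (η * ω) := by positivity
  have hηv : η * v = η * (J - Js) + η * e / 2 := by rw [hVKd]; ring
  have hgoal : v' - v = (J' - J) + (e' - e) / 2 := by rw [hVK', hVKd]; ring
  rw [hgoal, hsq]
  have hexp : -(η / 16) * v + η * (ω * (2 * κ * v + (2 * κ * Js + 6 * C + 1))) =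
      -(η * v) / 16 + 2 * (η * (κ * ω)) * (v + Js) + 6 * (C * (η * ω)) + η * ω := by ring
  rw [hexp, hηv]
  linarith

end Step
/-! ### From a one-step estimate to input-to-state stability -/

section ISS

/-- A positive antitone function has a positive continuous antitone minorant. -/
theorem exists_continuous_antitone_minorant {μ : ℝ → ℝ} (hμ : Antitone μ) (hpos : ∀ r, 0 < μ r) :
    ∃ g : ℝ → ℝ, Continuous g ∧ Antitone g ∧ (∀ r, 0 < g r) ∧ ∀ r, g r ≤ μ r := by
  have hint : ∀ a b, IntervalIntegrable μ MeasureTheory.volume a b := fun a b =>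
    hμ.intervalIntegrable
  have hshift : ∀ r, ∫ s in r..(r + 1), μ s = ∫ s in (0 : ℝ)..1, μ (r + s) := by
    intro r
    rw [intervalIntegral.integral_comp_add_left (fun s => μ s)]
    simp
  have hanti : ∀ r, Antitone fun s => μ (r + s) := fun r s t hst => hμ (by linarith)
  -- The average over `[r, r + 1]` smooths `μ` and looks only to the right, where `μ` is no larger.
  refine ⟨fun r => ∫ s in r..(r + 1), μ s, ?_, ?_, ?_, ?_⟩
  · have h1 := intervalIntegral.continuous_primitive hint 0
    have h2 : (fun r => ∫ s in r..(r + 1), μ s) =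
        fun r => (∫ s in (0 : ℝ)..(r + 1), μ s) - ∫ s in (0 : ℝ)..r, μ s := by
      ext r
      rw [intervalIntegral.integral_interval_sub_left (hint _ _) (hint _ _)]
    rw [h2]
    exact (h1.comp (continuous_id.add continuous_const)).sub h1
  · intro r s hrs
    simp only [hshift]
    exact intervalIntegral.integral_mono_on zero_le_one (hanti s).intervalIntegrable
      (hanti r).intervalIntegrable fun t _ => hμ (by linarith)
  · intro r
    exact intervalIntegral.intervalIntegral_pos_of_pos (hint _ _) hpos (by linarith)
  · intro r
    have := intervalIntegral.integral_mono_on (by linarith : r ≤ r + 1) (hint _ _)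
      (intervalIntegrable_const (c := μ r)) fun t ht => hμ ht.1
    simpa using this

theorem isClassKOn_mul_div_one_add {δ : ℝ} (hδ : 0 < δ) :
    IsClassKOn (Ici 0) fun r => δ * (r / (1 + r)) := by
  refine ⟨?_, ?_, by simp⟩
  · refine continuousOn_const.mul (continuousOn_id.div (by fun_prop) fun r hr => ?_)
    have : (0 : ℝ) ≤ r := hr
    positivity
  · intro r hr s hs hrs
    have hr' : (0 : ℝ) ≤ r := hr
    have hs' : (0 : ℝ) ≤ s := hs
    refine mul_lt_mul_of_pos_left ?_ hδ
    rw [div_lt_div_iff₀ (by positivity) (by positivity)]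
    nlinarith

/-- Antitonicity of `g` gives strict growth in `r`: a larger `r` also has a larger base `1 - g r`.
-/
theorem isClassKL_mul_rpow {g : ℝ → ℝ} (hg : Continuous g) (hanti : Antitone g)
    (hpos : ∀ r, 0 < g r) (hlt : ∀ r, g r < 1) :
    IsClassKL fun r t => r * (1 - g r) ^ t := by
  have hb : ∀ r, 0 < 1 - g r := fun r => sub_pos.2 (hlt r)
  refine ⟨fun t ht => ⟨?_, ?_, by simp⟩, fun r hr => ⟨?_, ?_⟩⟩
  · refine (continuous_id.mul ?_).continuousOn
    exact (continuous_const.sub hg).rpow_const fun r => Or.inl (hb r).ne'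
  · intro r hr s _ hrs
    have h1 : (1 - g r) ^ t ≤ (1 - g s) ^ t :=
      Real.rpow_le_rpow (hb r).le (by linarith [hanti hrs.le]) ht
    calc r * (1 - g r) ^ t ≤ r * (1 - g s) ^ t := mul_le_mul_of_nonneg_left h1 hr
      _ < s * (1 - g s) ^ t := mul_lt_mul_of_pos_right hrs (Real.rpow_pos_of_pos (hb s) t)
  · intro s _ t _ hst
    exact mul_le_mul_of_nonneg_left
      (Real.rpow_le_rpow_of_exponent_ge (hb r) (by linarith [hpos r]) hst) hr
  · have := tendsto_rpow_atTop_of_base_lt_one (1 - g r) (by linarith [hb r])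
      (by linarith [hpos r])
    simpa using this.const_mul r

variable {E U : Type*} [NormedAddCommGroup E] [NormedAddCommGroup U]

/-- Along every admissible step with a small enough disturbance, `V` decays at the rate `η / 16`, up to an error quadratic in the disturbance. -/
def OneStepEstimate (S : Set E) (F : E → U → Set E) (V η₀ : E → ℝ) (a b : ℝ) : Prop :=
  ∀ x ∈ S, ∀ u : U, a * ‖u‖ ^ 2 ≤ 1 → ∀ x' ∈ F x u, x' ∈ S ∧
    ∃ η, η₀ x ≤ η ∧ η ≤ 1 ∧ V x' - V x ≤ -(η / 16) * V x + η * (‖u‖ ^ 2 * (a * V x + b))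

theorem isSmallDisturbanceISSLyapunov_of_oneStepEstimate {S : Set E} {xs : E}
    {F : E → U → Set E} {V η₀ : E → ℝ} {g : ℝ → ℝ} {a b : ℝ} (ha : 0 < a) (hb : 0 < b)
    (hV : IsSizeFunction S xs V) (hV0 : ∀ x ∈ S, 0 ≤ V x) (hg : Continuous g)
    (hpos : ∀ r, 0 < g r) (hle : ∀ x ∈ S, g (V x) ≤ η₀ x)
    (hstep : OneStepEstimate S F V η₀ a b) : IsSmallDisturbanceISSLyapunov S xs F V := by
  -- Chosen so that `‖u‖ ≤ δ v/(1 + v)` keeps the error below `v/32`, half of the decay `v/16`.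
  set δ : ℝ := √(1 / (32 * (a + b))) with hδ
  have hab : 0 < a + b := add_pos ha hb
  have hδpos : 0 < δ := Real.sqrt_pos.2 (by positivity)
  have hδsq : 32 * (a + b) * δ ^ 2 = 1 := by
    rw [hδ, Real.sq_sqrt (by positivity)]
    field_simp
  refine ⟨hV, _, isClassKOn_mul_div_one_add hδpos, fun r => g r / 32 * r,
    ((hg.div_const _).mul continuous_id).continuousOn, by simp, fun r hr => ?_, ?_⟩
  · have := hpos r
    positivity
  intro x hx u hu x' hx'
  have hv := hV0 x hx
  set v := V x
  have hq0 : 0 ≤ v / (1 + v) := by positivity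
  have hq1 : v / (1 + v) ≤ 1 := by
    rw [div_le_one (by positivity)]; linarith
  have hqv : v / (1 + v) * (1 + v) = v := div_mul_cancel₀ _ (by positivity)
  set q := v / (1 + v)
  have husq : ‖u‖ ^ 2 ≤ δ ^ 2 * q := by
    calc ‖u‖ ^ 2 ≤ (δ * q) ^ 2 := pow_le_pow_left₀ (norm_nonneg _) hu 2
      _ = δ ^ 2 * q * q := by ring
      _ ≤ δ ^ 2 * q * 1 := mul_le_mul_of_nonneg_left hq1 (by positivity)
      _ = _ := mul_one _
  have hsmall : a * ‖u‖ ^ 2 ≤ 1 := by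
    have h1 : ‖u‖ ^ 2 ≤ δ ^ 2 := husq.trans (mul_le_of_le_one_right (by positivity) hq1)
    have h2 := mul_le_mul_of_nonneg_left h1 ha.le
    have h3 : 0 ≤ b * δ ^ 2 := by positivity
    have h4 : 0 ≤ a * δ ^ 2 := by positivity
    linarith
  obtain ⟨hS, η, hη, -, hdec⟩ := hstep x hx u hsmall x' hx'
  refine ⟨hS, ?_⟩
  have hη0 : g v ≤ η := (hle x hx).trans hη
  have herr : ‖u‖ ^ 2 * (a * v + b) ≤ v / 32 := by
    have h1 : a * v + b ≤ (a + b) * (1 + v) := by nlinarith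
    calc ‖u‖ ^ 2 * (a * v + b) ≤ δ ^ 2 * q * ((a + b) * (1 + v)) :=
          mul_le_mul husq h1 (by positivity) (by positivity)
      _ = (32 * (a + b) * δ ^ 2) * (q * (1 + v)) / 32 := by ring
      _ = v / 32 := by rw [hδsq, hqv, one_mul]
  have hηpos : 0 < η := (hpos _).trans_le hη0
  have h1 := mul_le_mul_of_nonneg_left herr hηpos.le
  have h2 := mul_le_mul_of_nonneg_right hη0 hv
  linarith

theorem smallDisturbanceISS_of_oneStepEstimate {S : Set E} {xs : E}
    {F : E → U → Set E} {V η₀ : E → ℝ} {g : ℝ → ℝ} {a b : ℝ} (ha : 0 < a) (hb : 0 < b)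
    (hV : IsSizeFunction S xs V) (hV0 : ∀ x ∈ S, 0 ≤ V x) (hg : Continuous g)
    (hanti : Antitone g) (hpos : ∀ r, 0 < g r) (hle : ∀ x ∈ S, g (V x) ≤ η₀ x)
    (hg1 : ∀ r, g r ≤ 1)
    (hstep : OneStepEstimate S F V η₀ a b) : SmallDisturbanceISS S xs F := by
  set δ : ℝ := √(1 / (32 * a)) with hδ
  have hδpos : 0 < δ := Real.sqrt_pos.2 (by positivity)
  have hδsq : 32 * a * δ ^ 2 = 1 := by
    rw [hδ, Real.sq_sqrt (by positivity)]
    field_simp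
  refine ⟨V, hV, ENNReal.ofReal δ, ENNReal.ofReal_pos.2 hδpos,
    fun r t => r * (1 - g r / 32) ^ t,
    isClassKL_mul_rpow (hg.div_const _) (fun r s h => by have := hanti h; linarith)
      (fun r => by have := hpos r; positivity) (fun r => by linarith [hg1 r]),
    fun s => 32 * b * s ^ 2, ⟨by fun_prop, ?_, by simp⟩, ?_⟩
  · intro r hr s _ hrs
    have hr' : 0 ≤ r := hr.1
    exact mul_lt_mul_of_pos_left (pow_lt_pow_left₀ hrs hr' two_ne_zero) (by positivity)
  intro x w hx0 hbdd hlt hF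
  set ω := ⨆ k, ‖w k‖
  have hw : ∀ k, ‖w k‖ ≤ ω := fun k => le_ciSup hbdd k
  have hω0 : 0 ≤ ω := (norm_nonneg _).trans (hw 0)
  have hωδ : ω < δ := (ENNReal.ofReal_lt_ofReal_iff hδpos).1 hlt
  have hwsq : ∀ k, ‖w k‖ ^ 2 ≤ ω ^ 2 := fun k => pow_le_pow_left₀ (norm_nonneg _) (hw k) 2
  have haω : 32 * (a * ω ^ 2) ≤ 1 := by
    have h1 : ω ^ 2 ≤ δ ^ 2 := pow_le_pow_left₀ hω0 hωδ.le 2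
    have h2 := mul_le_mul_of_nonneg_left h1 ha.le
    linarith
  -- With `32aω² ≤ 1`, half of the decay absorbs the error proportional to `V`; the rest contracts
  -- `V - ρ` by `1 - η/32`.
  set ρ := 32 * b * ω ^ 2 with hρ
  have hρ0 : 0 ≤ ρ := by positivity
  have hone : ∀ k, x k ∈ S → x (k + 1) ∈ S ∧
      ∃ η, η₀ (x k) ≤ η ∧ η ≤ 1 ∧ V (x (k + 1)) - ρ ≤ (1 - η / 32) * (V (x k) - ρ) := by
    intro k hk
    have hsmall : a * ‖w k‖ ^ 2 ≤ 1 := by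
      have := mul_le_mul_of_nonneg_left (hwsq k) ha.le
      have h0 : 0 ≤ a * ω ^ 2 := by positivity
      linarith
    obtain ⟨hS, η, hη, hη1, hdec⟩ := hstep _ hk _ hsmall _ (hF k)
    refine ⟨hS, η, hη, hη1, ?_⟩
    have hv := hV0 _ hk
    have hηpos : 0 < η := (hpos _).trans_le ((hle _ hk).trans hη)
    have h1 : ‖w k‖ ^ 2 * (a * V (x k) + b) ≤ V (x k) / 32 + ρ / 32 := by
      calc ‖w k‖ ^ 2 * (a * V (x k) + b) ≤ ω ^ 2 * (a * V (x k) + b) :=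
            mul_le_mul_of_nonneg_right (hwsq k) (by positivity)
        _ = (32 * (a * ω ^ 2)) * V (x k) / 32 + ρ / 32 := by rw [hρ]; ring
        _ ≤ 1 * V (x k) / 32 + ρ / 32 := by gcongr
        _ = _ := by rw [one_mul]
    have h2 := mul_le_mul_of_nonneg_left h1 hηpos.le
    linarith
  set v₀ := V (x 0) with hv₀
  have hv₀0 : 0 ≤ v₀ := hV0 _ hx0
  have hb0 : 0 ≤ 1 - g v₀ / 32 := by linarith [hg1 v₀]
  -- The level `ρ` is never left again, whatever the step size. Until it is reached `V` stays below
  -- `v₀`, so `η ≥ g v₀` and the contraction rate is uniform.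
  have hmain : ∀ k : ℕ, x k ∈ S ∧ V (x k) - ρ ≤ v₀ * (1 - g v₀ / 32) ^ k ∧
      (V (x k) ≤ ρ ∨ V (x k) ≤ v₀) := by
    intro k
    induction k with
    | zero => exact ⟨hx0, by rw [pow_zero, mul_one]; linarith, Or.inr le_rfl⟩
    | succ k ih =>
      obtain ⟨hk, hbound, hor⟩ := ih
      obtain ⟨hS, η, hη, hη1, hdec⟩ := hone k hk
      have hηpos : 0 < η := (hpos _).trans_le ((hle _ hk).trans hη)
      have hpow : 0 ≤ v₀ * (1 - g v₀ / 32) ^ k := by positivity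
      refine ⟨hS, ?_⟩
      rcases le_or_gt (V (x k)) ρ with hc | hc
      · have h1 : V (x (k + 1)) - ρ ≤ 0 :=
          hdec.trans (mul_nonpos_of_nonneg_of_nonpos (by linarith) (by linarith))
        refine ⟨h1.trans (by positivity), Or.inl (by linarith)⟩
      · have hv : V (x k) ≤ v₀ := hor.resolve_left (not_le.2 hc)
        have hgη : g v₀ ≤ η := (hanti hv).trans ((hle _ hk).trans hη)
        have h1 : (1 - η / 32) * (V (x k) - ρ) ≤ (1 - g v₀ / 32) * (V (x k) - ρ) :=
          mul_le_mul_of_nonneg_right (by linarith) (by linarith)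
        constructor
        · calc V (x (k + 1)) - ρ ≤ (1 - g v₀ / 32) * (V (x k) - ρ) := hdec.trans h1
            _ ≤ (1 - g v₀ / 32) * (v₀ * (1 - g v₀ / 32) ^ k) :=
              mul_le_mul_of_nonneg_left hbound hb0
            _ = v₀ * (1 - g v₀ / 32) ^ (k + 1) := by ring
        · right
          have h2 : (1 - η / 32) * (V (x k) - ρ) ≤ 1 * (V (x k) - ρ) :=
            mul_le_mul_of_nonneg_right (by linarith) (by linarith)
          linarith
  intro k
  refine ⟨(hmain k).1, ?_⟩
  have := (hmain k).2.1
  simp only [Real.rpow_natCast]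
  linarith

end ISS
/-! ### Newton's method for the Riccati equation -/

section Newton

variable {n m : ℕ} {A : Matrix (Fin n) (Fin n) ℝ} {B : Matrix (Fin n) (Fin m) ℝ}
  {Q : Matrix (Fin n) (Fin n) ℝ} {R : Matrix (Fin m) (Fin m) ℝ}

theorem riccati_add (A : Matrix (Fin n) (Fin n) ℝ) (B : Matrix (Fin n) (Fin m) ℝ)
    (Q : Matrix (Fin n) (Fin n) ℝ) (R : Matrix (Fin m) (Fin m) ℝ)
    (X N : Matrix (Fin n) (Fin n) ℝ) :
    riccati A B Q R (X + N) = riccati A B Q R X +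
      (Aᵀ * N + N * A - N * (B * R⁻¹ * Bᵀ) * X - X * (B * R⁻¹ * Bᵀ) * N) -
      N * (B * R⁻¹ * Bᵀ) * N := by
  simp only [riccati, Matrix.mul_add, Matrix.add_mul, Matrix.mul_assoc]
  abel

/-- The expansion at `X` has the quadratic remainder `-N BR⁻¹Bᵀ N`; symmetry of `X` turns the linear
part into the closed-loop Lyapunov operator. -/
theorem fderiv_riccati (hR : R.PosDef) {X : Matrix (Fin n) (Fin n) ℝ} (hX : Xᵀ = X)
    (N : Matrix (Fin n) (Fin n) ℝ) :
    fderiv ℝ (riccati A B Q R) X N =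
      (A - B * gainOf B R X)ᵀ * N + N * (A - B * gainOf B R X) := by
  set L := LinearMap.toContinuousLinearMap (𝕜 := ℝ) (E := Matrix (Fin n) (Fin n) ℝ)
    (lyapunovOp (A - B * gainOf B R X))
  have hL : ∀ N, L N = (A - B * gainOf B R X)ᵀ * N + N * (A - B * gainOf B R X) := fun _ => rfl
  have hexp : ∀ N, riccati A B Q R (X + N) - riccati A B Q R X - L N =
      -(N * (B * R⁻¹ * Bᵀ) * N) := by
    intro N
    rw [hL, riccati_add, gainOf]
    simp only [Matrix.transpose_sub, Matrix.transpose_mul, Matrix.transpose_transpose, hX,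
      hR.inv.transpose_eq, Matrix.sub_mul, Matrix.mul_sub, Matrix.mul_assoc]
    abel
  have ho : (fun N => riccati A B Q R (X + N) - riccati A B Q R X - L N) =o[𝓝 0] fun N => N := by
    simp only [hexp]
    refine Asymptotics.IsBigO.trans_isLittleO (g := fun N => ‖N‖ ^ 2) ?_ ?_
    · refine Asymptotics.IsBigO.of_bound ‖B * R⁻¹ * Bᵀ‖ (Eventually.of_forall fun N => ?_)
      rw [norm_neg, Real.norm_of_nonneg (sq_nonneg _)]
      calc ‖N * (B * R⁻¹ * Bᵀ) * N‖ ≤ ‖N * (B * R⁻¹ * Bᵀ)‖ * ‖N‖ := Matrix.frobenius_norm_mul _ _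
        _ ≤ ‖N‖ * ‖B * R⁻¹ * Bᵀ‖ * ‖N‖ :=
          mul_le_mul_of_nonneg_right (Matrix.frobenius_norm_mul _ _) (norm_nonneg _)
        _ = _ := by ring
    · exact Asymptotics.isLittleO_norm_pow_id one_lt_two
  have hderiv : HasFDerivAt (riccati A B Q R) L X :=
    (hasFDerivAt_iff_isLittleO_nhds_zero (E := Matrix (Fin n) (Fin n) ℝ)
      (F := Matrix (Fin n) (Fin n) ℝ)).2 ho
  rw [hderiv.fderiv, hL]

theorem fderiv_riccati_eq_neg_iff (hR : R.PosDef) {X : Matrix (Fin n) (Fin n) ℝ} (hX : Xᵀ = X)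
    (hK : gainOf B R X ∈ stabilizing A B) (N : Matrix (Fin n) (Fin n) ℝ) :
    fderiv ℝ (riccati A B Q R) X N = -riccati A B Q R X ↔
      N = costMatrix A B Q R (gainOf B R X) - X := by
  have hspec := costMatrix_spec (Q := Q) (R := R) hK
  have hF : IsHurwitz (A - B * gainOf B R X) := hK
  have hrhs : (A - B * gainOf B R X)ᵀ * (costMatrix A B Q R (gainOf B R X) - X) +
      (costMatrix A B Q R (gainOf B R X) - X) * (A - B * gainOf B R X) =
      -riccati A B Q R X := by
    rw [riccati_eq_lyapunov hR hX, Matrix.mul_sub, Matrix.sub_mul, sub_add_sub_comm, hspec]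
    abel
  rw [fderiv_riccati hR hX, ← hrhs]
  exact ⟨fun h => hF.injective_lyapunovOp h, fun h => by rw [h]⟩

end Newton

/-! ### Uniform step-size bounds and the main theorem -/

/-- The infimum of `η₀` over a compact cost sublevel set is attained, hence positive, and it
decreases with the level. -/
theorem exists_stepSize_minorant {n m : ℕ} {A : Matrix (Fin n) (Fin n) ℝ}
    {B : Matrix (Fin n) (Fin m) ℝ} {Q : Matrix (Fin n) (Fin n) ℝ} {R : Matrix (Fin m) (Fin m) ℝ}
    (hQ : Q.PosDef) (hR : R.PosDef) (hAB : IsStabilizable A B)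
    {η₀ : Matrix (Fin m) (Fin n) ℝ → ℝ} (hη : ContinuousOn η₀ (stabilizing A B))
    (hpos : ∀ K ∈ stabilizing A B, 0 < η₀ K) :
    ∃ g : ℝ → ℝ, Continuous g ∧ Antitone g ∧ (∀ r, 0 < g r) ∧
      ∀ K ∈ stabilizing A B, g (gaussNewtonLyapunov A B Q R K) ≤ η₀ K := by
  set Js := lqrCost A B Q R (optGain A B Q R)
  -- Truncating at zero keeps `K*` in every set, so the infimum is positive for negative `r` too.
  let C : ℝ → Set (Matrix (Fin m) (Fin n) ℝ) := fun r =>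
    {K | K ∈ stabilizing A B ∧ lqrCost A B Q R K ≤ max r 0 + Js}
  have hC : ∀ r, IsCompact (C r) := fun r => isCompact_lqrCost_sublevel hQ hR _
  have hne : ∀ r, (C r).Nonempty := fun r =>
    ⟨_, optGain_mem hQ hR hAB, le_add_of_nonneg_left (le_max_right r 0)⟩
  have hcont : ∀ r, ContinuousOn η₀ (C r) := fun r => hη.mono fun _ hK => hK.1
  have hbdd : ∀ r, BddBelow (η₀ '' C r) := fun r =>
    ((hC r).image_of_continuousOn (hcont r)).bddBelow
  obtain ⟨g, hg, hanti, hgpos, hle⟩ := exists_continuous_antitone_minorant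
    (μ := fun r => sInf (η₀ '' C r))
    (fun r s hrs => csInf_le_csInf (hbdd s) ((hne r).image _) (image_mono fun K hK =>
      ⟨hK.1, hK.2.trans (by gcongr)⟩))
    (fun r => by
      obtain ⟨K, hK, hmem⟩ := ((hC r).image_of_continuousOn (hcont r)).sInf_mem ((hne r).image _)
      rw [← hmem]
      exact hpos K hK.1)
  refine ⟨g, hg, hanti, hgpos, fun K hK => (hle _).trans (csInf_le (hbdd _) ⟨K, ⟨hK, ?_⟩, rfl⟩)⟩
  have h1 := lqrCost_sub_le_gaussNewtonLyapunov hQ hR hAB K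
  have h2 := le_max_left (gaussNewtonLyapunov A B Q R K) 0
  linarith

theorem mainTheorem5 {n m : ℕ}
    (A : Matrix (Fin n) (Fin n) ℝ) (B : Matrix (Fin n) (Fin m) ℝ)
    (Q : Matrix (Fin n) (Fin n) ℝ) (R : Matrix (Fin m) (Fin m) ℝ)
    (hQ : Q.PosDef) (hR : R.PosDef) (hAB : IsStabilizable A B) :
    (∀ η₀ : Matrix (Fin m) (Fin n) ℝ → ℝ, ContinuousOn η₀ (stabilizing A B) →
      (∀ K ∈ stabilizing A B, 0 < η₀ K ∧ η₀ K ≤ maxStep A B Q R K) →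
        SmallDisturbanceISS (stabilizing A B) (optGain A B Q R) (gaussNewton A B Q R η₀) ∧
        IsSmallDisturbanceISSLyapunov (stabilizing A B) (optGain A B Q R)
          (gaussNewton A B Q R η₀) (gaussNewtonLyapunov A B Q R)) ∧
    (∀ X : Matrix (Fin n) (Fin n) ℝ, X.IsSymm → gainOf B R X ∈ stabilizing A B →
      (∃! N : Matrix (Fin n) (Fin n) ℝ,
        fderiv ℝ (riccati A B Q R) X N = -riccati A B Q R X) ∧
      ∀ (η : ℝ) (X' : Matrix (Fin n) (Fin n) ℝ), IsNewtonStep A B Q R η X X' →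
        gainOf B R X' = gaussNewtonUpdate A B Q R η (gainOf B R X) 0) := by
  refine ⟨fun η₀ hη hη' => ?_, fun X hX hK => ⟨?_, ?_⟩⟩
  · obtain ⟨g, hg, hanti, hpos, hle⟩ :=
      exists_stepSize_minorant hQ hR hAB hη fun K hK => (hη' K hK).1
    obtain ⟨a, b, ha, hb, hstep⟩ := gaussNewtonLyapunov_step hQ hR hAB
    have hV := isSizeFunction_gaussNewtonLyapunov hQ hR hAB
    have hV0 : ∀ K ∈ stabilizing A B, 0 ≤ gaussNewtonLyapunov A B Q R K :=
      fun K hK => gaussNewtonLyapunov_nonneg hQ hR hAB hK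
    have hone : OneStepEstimate (stabilizing A B) (gaussNewton A B Q R η₀)
        (gaussNewtonLyapunov A B Q R) η₀ a b := by
      rintro K hK W hW _ ⟨η, hηK, rfl⟩
      obtain ⟨h1, h2⟩ := hηK hK
      obtain ⟨h3, h4⟩ := hstep K hK W η hW ((hη' K hK).1.le.trans h1) h2
      exact ⟨h3, η, h1, h2.trans (min_le_left _ _), h4⟩
    refine ⟨?_, isSmallDisturbanceISSLyapunov_of_oneStepEstimate ha hb hV hV0 hg hpos hle hone⟩
    -- Capping `g` at one keeps the base `1 - g/32` positive for every argument.
    exact smallDisturbanceISS_of_oneStepEstimate ha hb hV hV0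
      (hg.min continuous_const) (hanti.min antitone_const) (fun r => lt_min (hpos r) one_pos)
      (fun K hK => (min_le_left _ _).trans (hle K hK)) (fun r => min_le_right _ _) hone
  · exact ⟨_, (fderiv_riccati_eq_neg_iff hR hX hK _).2 rfl,
      fun N hN => (fderiv_riccati_eq_neg_iff hR hX hK N).1 hN⟩
  · rintro η X' ⟨N, hN, rfl⟩
    rw [(fderiv_riccati_eq_neg_iff hR hX hK N).1 hN, gaussNewtonUpdate, add_zero]
    simp only [gainOf, Matrix.mul_add, Matrix.mul_smul, Matrix.mul_sub]
    module
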